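/- **Definitions.** Let $K$ be a field, $m\ge 0$ and $\sigma\ge 1$ integers, $E\in K^{m\times\sigma}$ with rows $e_1,\dots,e_m$, $M\in K^{\sigma\times\sigma}$ an arbitrary matrix, and $s=(s_1,\dots,s_m)\in\mathbb N^m$ (a shift). * An *interpolant* for $(E,M)$ is a row vector $p=(p_1,\dots,p_m)\in K[X]^m$ with $e_1p_1(M)+\cdots+e_mp_m(M)=0$. The interpolants form a $K[X]$-submodule of $K[X]^m$; an *interpolation basis* for $(E,M)$ is a matrix $P\in K[X]^{m\times m}$ whose rows form a basis of this module. * The $s$-*row degree* of a nonzero row $p$ is $\max_j(\deg p_j+s_j)$. A matrix $P\in K[X]^{m\times m}$ without zero row, whose rows have $s$-row degrees $d_1,\dots,d_m$, is $s$-*reduced* if its $s$-leading matrix, with $(i,j)$ entry the coefficient of degree $d_i-s_j$ in $P_{i,j}$, is invertible. An $s$-*minimal* interpolation basis is an interpolation basis that is $s$-reduced. * The $s$-*pivot index* of a nonzero row $p$ is the largest $j$ for which $\deg p_j+s_j$ equals the $s$-row degree of $p$. A nonsingular $P\in K[X]^{m\times m}$ is in $s$-*Popov form* if for every $i$ the $s$-pivot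 index of row $i$ is $i$ and $P_{i,i}$ is monic, and $\deg P_{i,j}<\deg P_{j,j}$ for all $i\neq j$. * A *deterministic algorithm* is a family of algebraic computation trees, one for each choice of the integer data $(m,\sigma,s,\delta)$, which do not depend on the field. The input consists of the entries of $E$ and $M$. At each node the tree performs one operation $+,-,\times,\div$ on inputs, earlier results and the constants $0,1$, or branches on whether such an element is zero; each of these counts as one operation in $K$, and no division by zero ever occurs. A leaf returns the lists of coefficients of the entries of an $m\times m$ polynomial matrix, each coefficient being an input, an earlier result, $0$ or $1$. * A real number $\omega$ is an *admissible exponent* of matrix multiplication if there is a constant $C_0$ such that for every $n\ge1$ some straight-line program with constants $0,1$ computes the product of two $n\times n$ matrices over every ring with at most $C_0n^\omega$ ring operations $+,-,\times$. **Theorem.** Let $\omega$ be an admissible exponent of matrix multiplication. There are a deterministic algorithm and a constant $C$ (depending only on $\omega$) such that the following holds for every field $K$, all $m$, all $\sigma\ge 1$, all $E\in K^{m\times\sigma}$, $M\in K^{\sigma\times\sigma}$, $s\in\mathbb N^m$, and every integer $\delta$ that is at least the degree of the minimal polynomial of $M$. On input $(E,M)$, the algorithm for $(m,\sigma,s,\delta)$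 returns an $s$-minimal interpolation basis $P$ for $(E,M)$ which is in $s$-Popov form, and $P$ is the unique interpolation basis for $(E,M)$ in $s$-Popov form. The number of operations in $K$ is at most $$C\,\sigma^{\omega}\bigl(\lceil m/\sigma\rceil+\log_2\delta\bigr)\ \text{ if }\omega>2,\qquad C\,\sigma^{2}\bigl(\lceil m/\sigma\rceil+\log_2\delta\bigr)\max(1,\log_2\sigma)\ \text{ if }\omega=2 .$$ Moreover all entries of $P$ have degree at most $\delta$, and the sum of the column degrees of $P$ is at most $\sigma$. Since the minimal polynomial of $M$ has degree at most $\sigma$, one may always take $\delta=\sigma$, which gives the bounds $O(\sigma^\omega(\lceil m/\sigma\rceil+\log\sigma))$ for $\omega>2$ and $O(\sigma^2(\lceil m/\sigma\rceil+\log\sigma)\max(1,\log\sigma))$ for $\omega=2$. -/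

import Mathlib

open Polynomial

universe u

/-! ### Programs over rings and fields, with a count of the operations -/

/-- The arithmetic operations available in every ring. -/
inductive ArithOp : Type
  | add
  | sub
  | mul

/-- The value of an arithmetic operation in the ring `R`. -/
def ArithOp.eval {R : Type*} [Ring R] : ArithOp → R → R → R
  | .add, x, y => x + y
  | .sub, x, y => x - y
  | .mul, x, y => x * y

/-- What an instruction may refer to: the constants `0` and `1`, an input (the inputs are indexed
by `ι`), or the result `reg k` of the `k`-th operation performed so far (counting from `0`). -/
inductive Operand (ι : Type) : Type
  | zero
  | one
  | input (i : ι)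
  | reg (k : ℕ)

/-- The value of an operand, given the inputs and the list of the results of all operations
performed so far. A reference to a result that does not exist yet reads the constant `0`. -/
def Operand.eval {ι : Type} {R : Type*} [Ring R] (inp : ι → R) (regs : List R) : Operand ι → R
  | .zero => 0
  | .one => 1
  | .input i => inp i
  | .reg k => regs.getD k 0

/-- A straight-line program over rings: a list of instructions (operation, two operands), and an
operand for each of the outputs (indexed by `ο`). The same program can be run in every ring. -/
structure RingProgram (ι ο : Type) : Type where
  code : List (ArithOp × Operand ι × Operand ι)
  out : ο → Operand ι

/-- The results of all the operations of a straight-line program, in order. -/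
def RingProgram.results {ι ο : Type} (p : RingProgram ι ο) {R : Type*} [Ring R] (inp : ι → R) :
    List R :=
  p.code.foldl
    (fun regs c => regs ++ [c.1.eval (c.2.1.eval inp regs) (c.2.2.eval inp regs)]) []

/-- The outputs of a straight-line program. -/
def RingProgram.eval {ι ο : Type} (p : RingProgram ι ο) {R : Type*} [Ring R] (inp : ι → R)
    (o : ο) : R :=
  (p.out o).eval inp (p.results inp)

/-- The number of ring operations performed by a straight-line program. -/
def RingProgram.cost {ι ο : Type} (p : RingProgram ι ο) : ℕ := p.code.length

/-- The inputs of an algorithm that takes two matrices: the entries of both. -/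
abbrev TwoMatrices (k l m n : ℕ) : Type := (Fin k × Fin l) ⊕ (Fin m × Fin n)

/-- The entries of two matrices as one family. -/
def matrixInputs {R : Type*} {k l m n : ℕ} (A : Matrix (Fin k) (Fin l) R)
    (B : Matrix (Fin m) (Fin n) R) : TwoMatrices k l m n → R :=
  Sum.elim (fun x => A x.1 x.2) (fun x => B x.1 x.2)

/-- `ω` is an admissible exponent for matrix multiplication: two `n × n` matrices can be multiplied
in `O(n ^ ω)` ring operations, over any ring. -/
def IsMatMulExponent (ω : ℝ) : Prop :=
  ∃ C : ℝ, ∀ n : ℕ, 1 ≤ n → ∃ p : RingProgram (TwoMatrices n n n n) (Fin n × Fin n),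
    (p.cost : ℝ) ≤ C * (n : ℝ) ^ ω ∧
      ∀ (R : Type u) [Ring R] (A B : Matrix (Fin n) (Fin n) R) (i j : Fin n),
        p.eval (matrixInputs A B) (i, j) = (A * B) i j

/-- A deterministic program over fields, in the form of a finite algebraic computation tree.
Each node performs one arithmetic operation or one division, whose result is appended to the list
of results, or branches according to whether a field element is zero. The same program can be
run in every field. -/
inductive FieldProgram (ι Out : Type) : Type
  | done (out : Out)
  | arith (op : ArithOp) (x y : Operand ι) (next : FieldProgram ι Out)
  | div (x y : Operand ι) (next : FieldProgram ι Out)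
  | ifZero (x : Operand ι) (yes no : FieldProgram ι Out)

/-- What a finished run leaves: the results of the operations performed, the output description
found at the leaf, and the number of operations performed. -/
structure Outcome (K : Type*) (Out : Type) where
  regs : List K
  out : Out
  ops : ℕ

/-- One more operation performed. -/
def Outcome.tick {K : Type*} {Out : Type} (r : Outcome K Out) : Outcome K Out :=
  { r with ops := r.ops + 1 }

open Classical in
/-- Running a program, starting from the list `regs` of results. Each arithmetic operation, each
division and each zero test costs one operation; the run fails on a division by zero. -/
noncomputable def FieldProgram.run {ι Out : Type} {K : Type*} [Field K] (inp : ι → K) :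
    FieldProgram ι Out → List K → Option (Outcome K Out)
  | .done out, regs => some ⟨regs, out, 0⟩
  | .arith op x y next, regs =>
      (next.run inp (regs ++ [op.eval (x.eval inp regs) (y.eval inp regs)])).map Outcome.tick
  | .div x y next, regs =>
      if y.eval inp regs = 0 then none
      else (next.run inp (regs ++ [x.eval inp regs / y.eval inp regs])).map Outcome.tick
  | .ifZero x yes no, regs =>
      if x.eval inp regs = 0 then (yes.run inp regs).map Outcome.tick
      else (no.run inp regs).map Outcome.tick

/-- The polynomial with the given list of coefficients, the constant coefficient first. -/
noncomputable def polyOfCoeffs {K : Type*} [Field K] : List K → K[X]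
  | [] => 0
  | a :: l => C a + X * polyOfCoeffs l

/-- Programs that take an `m × σ` matrix and a `σ × σ` matrix over a field and return an `m × m`
matrix of polynomials, each given by the list of its coefficients. -/
abbrev PolyMatProgram (m σ : ℕ) : Type :=
  FieldProgram (TwoMatrices m σ σ σ) (Fin m → Fin m → List (Operand (TwoMatrices m σ σ σ)))

/-- On input `(E, M)`, the program returns the polynomial matrix `P` after `t` operations. -/
def PolyMatProgram.Returns {K : Type*} [Field K] {m σ : ℕ} (p : PolyMatProgram m σ)
    (E : Matrix (Fin m) (Fin σ) K) (M : Matrix (Fin σ) (Fin σ) K)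
    (P : Matrix (Fin m) (Fin m) K[X]) (t : ℕ) : Prop :=
  ∃ r, FieldProgram.run (matrixInputs E M) p [] = some r ∧ r.ops = t ∧
    ∀ i j, P i j = polyOfCoeffs ((r.out i j).map (Operand.eval (matrixInputs E M) r.regs))

/-! ### Interpolation bases -/

section Interpolation

variable {K : Type*} [Field K] {m σ : ℕ}

/-- `p · E = p₁ · e₁ + ⋯ + pₘ · eₘ`, where `e₁, …, eₘ` are the rows of `E` and where
`p · e = e p(M)` for a polynomial `p` and a row vector `e`. -/
noncomputable def polyAct (E : Matrix (Fin m) (Fin σ) K) (M : Matrix (Fin σ) (Fin σ) K)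
    (p : Fin m → K[X]) : Fin σ → K :=
  ∑ i, Matrix.vecMul (E i) (aeval M (p i))

/-- The module of all interpolants for `(E, M)`. -/
noncomputable def interpolants (E : Matrix (Fin m) (Fin σ) K) (M : Matrix (Fin σ) (Fin σ) K) :
    Submodule K[X] (Fin m → K[X]) where
  carrier := {p | polyAct E M p = 0}
  zero_mem' := by simp [polyAct]
  add_mem' := by
    intro p q hp hq
    simp only [Set.mem_ofPred_eq, polyAct] at hp hq ⊢
    simp [Matrix.vecMul_add, Finset.sum_add_distrib, hp, hq]
  smul_mem' := by
    intro c p hp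
    simp only [Set.mem_ofPred_eq, polyAct] at hp ⊢
    have h : ∀ i, Matrix.vecMul (E i) (aeval M ((c • p) i))
        = Matrix.vecMul (Matrix.vecMul (E i) (aeval M (p i))) (aeval M c) := by
      intro i
      rw [Matrix.vecMul_vecMul, ← map_mul, Pi.smul_apply, smul_eq_mul, mul_comm]
    simp only [h]
    rw [← Matrix.sum_vecMul, hp, Matrix.zero_vecMul]

/-- `P` is an interpolation basis for `(E, M)`: its rows form a basis of the module of
interpolants. -/
def IsInterpolationBasis (E : Matrix (Fin m) (Fin σ) K) (M : Matrix (Fin σ) (Fin σ) K)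
    (P : Matrix (Fin m) (Fin m) K[X]) : Prop :=
  LinearIndependent K[X] (fun i => P i) ∧
    Submodule.span K[X] (Set.range fun i => P i) = interpolants E M

/-- The `s`-row degree `max_j (deg p_j + s_j)` of a row vector; it is `⊥` for the zero vector. -/
noncomputable def rowDeg (s : Fin m → ℕ) (p : Fin m → K[X]) : WithBot ℕ :=
  Finset.univ.sup fun j => (p j).degree + (s j : WithBot ℕ)

open Classical in
/-- The `s`-leading matrix of `P`: with `d_i` the `s`-row degree of row `i`, its entry `(i, j)` is
the coefficient of `X ^ (d_i - s_j)` in `P i j`, which is nonzero only if the `s`-row degree is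
attained at `j`. -/
noncomputable def leadingMatrix (s : Fin m → ℕ) (P : Matrix (Fin m) (Fin m) K[X]) :
    Matrix (Fin m) (Fin m) K :=
  Matrix.of fun i j =>
    if (P i j).degree + (s j : WithBot ℕ) = rowDeg s (P i) then (P i j).leadingCoeff else 0

/-- A square matrix is `s`-reduced if it has no zero row and its `s`-leading matrix is
invertible. -/
def IsShiftReduced (s : Fin m → ℕ) (P : Matrix (Fin m) (Fin m) K[X]) : Prop :=
  (∀ i, P i ≠ 0) ∧ IsUnit (leadingMatrix s P)

/-- `P` is an `s`-minimal interpolation basis for `(E, M)`. -/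
def IsMinimalInterpolationBasis (s : Fin m → ℕ) (E : Matrix (Fin m) (Fin σ) K)
    (M : Matrix (Fin σ) (Fin σ) K) (P : Matrix (Fin m) (Fin m) K[X]) : Prop :=
  IsInterpolationBasis E M P ∧ IsShiftReduced s P

/-- `c` is the `s`-pivot index of the nonzero row vector `p`: the largest index at which the
`s`-row degree is attained. -/
def IsPivotIndex (s : Fin m → ℕ) (p : Fin m → K[X]) (c : Fin m) : Prop :=
  p ≠ 0 ∧ (p c).degree + (s c : WithBot ℕ) = rowDeg s p ∧
    ∀ c', c < c' → (p c').degree + (s c' : WithBot ℕ) ≠ rowDeg s p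

/-- `P` is in `s`-Popov form: it is nonsingular, the `s`-pivot entries are monic and on the
diagonal, and in each column the other entries have degree less than the pivot entry. -/
def IsPopov (s : Fin m → ℕ) (P : Matrix (Fin m) (Fin m) K[X]) : Prop :=
  P.det ≠ 0 ∧ (∀ i, IsPivotIndex s (P i) i ∧ (P i i).Monic) ∧
    ∀ i j, i ≠ j → (P i j).degree < (P j j).degree

/-- The degree of column `j` of `P`. -/
noncomputable def colDeg (P : Matrix (Fin m) (Fin m) K[X]) (j : Fin m) : ℕ :=
  Finset.univ.sup fun i => (P i j).natDegree

end Interpolation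

/-! Order the monomials `X ^ d e_i` by `(d + s_i, i)` lexicographically; multiplication by a power
of `X` respects this order. Attach to `X ^ d e_i` the vector `e_i M ^ d`, so that interpolants are
exactly the linear relations among these vectors. A monomial is standard if its vector is not a
combination of the vectors of smaller monomials. Multiplying such a combination by `M` shows that
nonstandardness passes from `X ^ d e_i` to `X ^ (d + 1) e_i`, so the standard monomials at position
`i` are those with `d < e i`. Their vectors are independent in `K ^ σ`, whence `∑ e i ≤ σ`, and
reduction modulo the minimal polynomial of `M` gives `e i ≤ δ`.

The vector of `X ^ (e i) e_i` is a combination of vectors of smaller standard monomials; the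
resulting relation is row `i` of `P`. Division by these rows leaves a remainder supported on
standard monomials, and an interpolant of that kind is zero, so the rows generate
(`span_of_relations`). Leading monomials of interpolants are nonstandard, which gives the Popov form
(`isPopov_of_relations`) and its uniqueness (`eq_of_relations`).

The standard monomials are found by doubling. If `S` is the standard set in degrees below `N`, the
standard set below `2 N` is that of `S ∪ X ^ N S`, at most `2 σ` candidates
(`isStandard_double_iff`). Hence about `log δ` squarings of `M` and row rank profiles suffice; the
`m` monomials of degree zero enter in `⌈m / σ⌉` chunks of size at most `σ`.

A row rank profile is computed by halving the rows and passing to a Schur complement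
(`Matrix.IsRankInverse.append`), together with an inner inverse `G` that later turns all the vectors
of the `X ^ (e i) e_i` into coordinates by one matrix product. With `r = 2 ^ (ω - 2)`, a profile of
size comparable to `σ` costs a constant times `σ ^ 2 ∑ r ^ i`, the sum running over the levels of
the recursion: a geometric sum if `ω > 2`, and about `log σ` equal terms if `ω = 2`. -/

/-! ### Composing programs -/

/-- Runs `p`, then continues with `f`, which is told the output of `p` and the number of results
present when `p` ends, provided that `n` results are present when `p` starts. -/
def FieldProgram.graft {ι α β : Type} :
    FieldProgram ι α → ℕ → (α → ℕ → FieldProgram ι β) → FieldProgram ι β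
  | .done a, n, f => f a n
  | .arith op x y next, n, f => .arith op x y (next.graft (n + 1) f)
  | .div x y next, n, f => .div x y (next.graft (n + 1) f)
  | .ifZero x yes no, n, f => .ifZero x (yes.graft n f) (no.graft n f)

/-- A computation: a program that may depend on the number of results already present. -/
def Comp (ι α : Type) : Type := ℕ → FieldProgram ι α

/-- The output of a computation is fixed by the leaf reached, so the continuation may depend on it,
for instance on an index set, without spending operations. Passing on the number of results lets
each new result be named in advance. -/
instance {ι : Type} : Monad (Comp ι) where
  pure a := fun _ => .done a
  bind c f := fun n => (c n).graft n f

/-! ### Correctness and cost of composed programs -/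

section Semantics

variable {ι α β : Type} {K : Type*} [Field K] {inp : ι → K}

/-- The counter carried by `graft` agrees with the length of the list of results because an
arithmetic operation or a division appends exactly one entry, and a zero test none. -/
theorem FieldProgram.run_graft (f : α → ℕ → FieldProgram ι β) (p : FieldProgram ι α) :
    ∀ (regs : List K) (r : Outcome K α) (r' : Outcome K β), p.run inp regs = some r →
      (f r.out r.regs.length).run inp r.regs = some r' →
      (p.graft regs.length f).run inp regs = some { r' with ops := r.ops + r'.ops } := by
  induction p with
  | done a =>
    intro regs r r' h h'
    simp only [FieldProgram.run, Option.some.injEq] at h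
    subst h
    simpa [FieldProgram.graft] using h'
  | arith op x y next ih =>
    intro regs r r' h h'
    simp only [FieldProgram.run, Option.map_eq_some_iff] at h
    obtain ⟨r₀, h₀, rfl⟩ := h
    have := ih _ r₀ r' h₀ h'
    rw [List.length_append, List.length_singleton] at this
    simp only [FieldProgram.graft, FieldProgram.run, this]
    simp [Outcome.tick, add_right_comm]
  | div x y next ih =>
    intro regs r r' h h'
    simp only [FieldProgram.run] at h
    split_ifs at h with hy
    simp only [Option.map_eq_some_iff] at h
    obtain ⟨r₀, h₀, rfl⟩ := h
    have := ih _ r₀ r' h₀ h'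
    rw [List.length_append, List.length_singleton] at this
    simp only [FieldProgram.graft, FieldProgram.run, this, if_neg hy]
    simp [Outcome.tick, add_right_comm]
  | ifZero x yes no ih₁ ih₂ =>
    intro regs r r' h h'
    simp only [FieldProgram.run] at h
    split_ifs at h with hx <;> simp only [Option.map_eq_some_iff] at h <;>
      obtain ⟨r₀, h₀, rfl⟩ := h
    · have := ih₁ _ r₀ r' h₀ h'
      simp only [FieldProgram.graft, FieldProgram.run, this, if_pos hx]
      simp [Outcome.tick, add_right_comm]
    · have := ih₂ _ r₀ r' h₀ h'
      simp only [FieldProgram.graft, FieldProgram.run, this, if_neg hx]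
      simp [Outcome.tick, add_right_comm]

/-- Started with the results `regs`, the computation `c` succeeds after at most `T` operations,
keeps the results `regs`, and its final results and its output satisfy `Q`. -/
def Comp.Sat (inp : ι → K) (regs : List K) (c : Comp ι α) (T : ℕ) (Q : List K → α → Prop) :
    Prop :=
  ∃ r, (c regs.length).run inp regs = some r ∧ regs <+: r.regs ∧ r.ops ≤ T ∧ Q r.regs r.out

namespace Comp

theorem Sat.mono {regs : List K} {c : Comp ι α} {T T' : ℕ} {Q Q' : List K → α → Prop}
    (h : c.Sat inp regs T Q) (hT : T ≤ T') (hQ : ∀ rs a, regs <+: rs → Q rs a → Q' rs a) :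
    c.Sat inp regs T' Q' := by
  obtain ⟨r, h₁, h₂, h₃, h₄⟩ := h
  exact ⟨r, h₁, h₂, h₃.trans hT, hQ _ _ h₂ h₄⟩

theorem Sat.le {regs : List K} {c : Comp ι α} {T T' : ℕ} {Q : List K → α → Prop}
    (h : c.Sat inp regs T Q) (hT : T ≤ T') : c.Sat inp regs T' Q :=
  h.mono hT fun _ _ _ => id

theorem sat_pure {regs : List K} {a : α} {T : ℕ} {Q : List K → α → Prop} (h : Q regs a) :
    (pure a : Comp ι α).Sat inp regs T Q :=
  ⟨⟨regs, a, 0⟩, rfl, List.prefix_rfl, Nat.zero_le _, h⟩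

theorem Sat.bind {regs : List K} {c : Comp ι α} {f : α → Comp ι β} {T₁ T₂ : ℕ}
    {Q₁ : List K → α → Prop} {Q : List K → β → Prop} (h : c.Sat inp regs T₁ Q₁)
    (hf : ∀ rs a, regs <+: rs → Q₁ rs a → (f a).Sat inp rs T₂ Q) :
    (c >>= f).Sat inp regs (T₁ + T₂) Q := by
  obtain ⟨r, h₁, h₂, h₃, h₄⟩ := h
  obtain ⟨r', h₁', h₂', h₃', h₄'⟩ := hf _ _ h₂ h₄
  exact ⟨_, FieldProgram.run_graft f _ _ _ _ h₁ h₁', h₂.trans h₂', add_le_add h₃ h₃', h₄'⟩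

/-- The operand `x` holds the value `v`, now and whatever results are added. -/
def _root_.Operand.Holds (inp : ι → K) (regs : List K) (x : Operand ι) (v : K) : Prop :=
  ∀ rs, regs <+: rs → x.eval inp rs = v

theorem _root_.Operand.Holds.mono {regs rs : List K} {x : Operand ι} {v : K}
    (h : x.Holds inp regs v) (hle : regs <+: rs) : x.Holds inp rs v :=
  fun _ h' => h _ (hle.trans h')

theorem _root_.Operand.Holds.eval {regs : List K} {x : Operand ι} {v : K}
    (h : x.Holds inp regs v) : x.eval inp regs = v := h _ List.prefix_rfl

theorem _root_.Operand.holds_zero (regs : List K) :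
    (Operand.zero : Operand ι).Holds inp regs 0 := fun _ _ => rfl

theorem _root_.Operand.holds_one (regs : List K) :
    (Operand.one : Operand ι).Holds inp regs 1 := fun _ _ => rfl

theorem _root_.Operand.holds_input (regs : List K) (i : ι) :
    (Operand.input i).Holds inp regs (inp i) := fun _ _ => rfl

theorem _root_.Operand.holds_reg (regs : List K) {k : ℕ} (hk : k < regs.length) :
    (Operand.reg k : Operand ι).Holds inp regs (regs.getD k 0) := by
  rintro _ ⟨t, rfl⟩
  simp [Operand.eval, List.getElem?_append_left hk]

/-- One arithmetic operation. -/
def arith (op : ArithOp) (x y : Operand ι) : Comp ι (Operand ι) :=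
  fun n => .arith op x y (.done (.reg n))

theorem sat_arith {regs : List K} (op : ArithOp) {x y : Operand ι} {a b : K}
    (hx : x.Holds inp regs a) (hy : y.Holds inp regs b) :
    (arith op x y).Sat inp regs 1 fun rs z => z.Holds inp rs (op.eval a b) := by
  refine ⟨_, rfl, List.prefix_append _ _, le_rfl, ?_⟩
  have := Operand.holds_reg (inp := inp)
    (regs ++ [op.eval (x.eval inp regs) (y.eval inp regs)]) (k := regs.length) (by simp)
  simpa [Outcome.tick, hx.eval, hy.eval] using this

/-- One division. -/
def div (x y : Operand ι) : Comp ι (Operand ι) := fun n => .div x y (.done (.reg n))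

theorem sat_div {regs : List K} {x y : Operand ι} {a b : K}
    (hx : x.Holds inp regs a) (hy : y.Holds inp regs b) (hb : b ≠ 0) :
    (div x y).Sat inp regs 1 fun rs z => z.Holds inp rs (a / b) := by
  refine ⟨⟨regs ++ [a / b], .reg regs.length, 1⟩, ?_, List.prefix_append _ _, le_rfl, ?_⟩
  · simp [div, FieldProgram.run, hx.eval, hy.eval, hb, Outcome.tick]
  · have := Operand.holds_reg (inp := inp) (regs ++ [a / b]) (k := regs.length) (by simp)
    simpa using this

/-- One zero test. -/
def isZero (x : Operand ι) : Comp ι Bool := fun _ => .ifZero x (.done true) (.done false)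

theorem sat_isZero {regs : List K} {x : Operand ι} {a : K} (hx : x.Holds inp regs a) :
    (isZero x).Sat inp regs 1 fun _ b => b = true ↔ a = 0 := by
  by_cases h : a = 0
  · refine ⟨⟨regs, true, 1⟩, ?_, List.prefix_rfl, le_rfl, by simp [h]⟩
    simp [isZero, FieldProgram.run, hx.eval, h, Outcome.tick]
  · refine ⟨⟨regs, false, 1⟩, ?_, List.prefix_rfl, le_rfl, by simp [h]⟩
    simp [isZero, FieldProgram.run, hx.eval, h, Outcome.tick]

/-- Performs the computations `f 0, f 1, …` in turn and returns all outputs. -/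
def forFin : (n : ℕ) → (Fin n → Comp ι α) → Comp ι (Fin n → α)
  | 0, _ => pure Fin.elim0
  | n + 1, f => f 0 >>= fun a => forFin n (fun i => f i.succ) >>= fun g => pure (Fin.cons a g)

/-- The first hypothesis carries each postcondition over the results appended by the later
iterations. -/
theorem sat_forFin {T : ℕ} : ∀ {n : ℕ} {f : Fin n → Comp ι α} {Q : Fin n → List K → α → Prop}
    {regs : List K} (_ : ∀ i rs rs' a, rs <+: rs' → Q i rs a → Q i rs' a)
    (_ : ∀ i rs, regs <+: rs → (f i).Sat inp rs T (Q i)),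
    (forFin n f).Sat inp regs (n * T) fun rs g => ∀ i, Q i rs (g i)
  | 0, _, _, _, _, _ => sat_pure fun i => i.elim0
  | n + 1, f, Q, regs, hQ, hf => by
    have := Sat.bind (hf 0 regs List.prefix_rfl) (T₂ := n * T)
      (f := fun a => forFin n (fun i => f i.succ) >>= fun g => pure (Fin.cons a g))
      (Q := fun rs g => ∀ i, Q i rs (g i)) fun rs a hrs ha =>
        (Sat.bind (T₂ := 0) (sat_forFin (fun i => hQ i.succ)
          (fun i rs' h' => hf i.succ rs' (hrs.trans h'))) fun rs' g hrs' hg =>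
            sat_pure (Fin.cases (hQ 0 _ _ _ hrs' ha) hg))
    exact this.le (by rw [Nat.succ_mul, add_comm])

/-- The matrix of operands `A` holds the matrix `A'`. -/
def _root_.Matrix.Holds {μ ν : Type*} (inp : ι → K) (regs : List K)
    (A : Matrix μ ν (Operand ι)) (A' : Matrix μ ν K) : Prop :=
  ∀ i j, (A i j).Holds inp regs (A' i j)

theorem _root_.Matrix.Holds.mono {μ ν : Type*} {regs rs : List K}
    {A : Matrix μ ν (Operand ι)} {A' : Matrix μ ν K}
    (h : A.Holds inp regs A') (hle : regs <+: rs) : A.Holds inp rs A' :=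
  fun i j => (h i j).mono hle

/-- Applies an arithmetic operation entrywise to two matrices. -/
def entrywise (op : ArithOp) {a b : ℕ} (A B : Matrix (Fin a) (Fin b) (Operand ι)) :
    Comp ι (Matrix (Fin a) (Fin b) (Operand ι)) :=
  forFin a fun i => forFin b fun j => arith op (A i j) (B i j)

theorem sat_entrywise {regs : List K} (op : ArithOp) {a b : ℕ}
    {A B : Matrix (Fin a) (Fin b) (Operand ι)} {A' B' : Matrix (Fin a) (Fin b) K}
    (hA : A.Holds inp regs A') (hB : B.Holds inp regs B') :
    (entrywise op A B).Sat inp regs (a * b) fun rs D =>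
      D.Holds inp rs (Matrix.of fun i j => op.eval (A' i j) (B' i j)) := by
  refine (sat_forFin (T := b)
    (Q := fun i rs (g : Fin b → Operand ι) => ∀ j, (g j).Holds inp rs (op.eval (A' i j) (B' i j)))
    (fun i rs rs' g h hg j => (hg j).mono h) fun i rs h => ?_)
  exact (sat_forFin (T := 1)
    (Q := fun j rs (z : Operand ι) => z.Holds inp rs (op.eval (A' i j) (B' i j)))
    (fun _ _ _ _ h hz => hz.mono h) fun j rs' h' =>
      sat_arith op ((hA i j).mono (h.trans h')) ((hB i j).mono (h.trans h'))).le (by simp)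

theorem sat_entrywise_add {regs : List K} {a b : ℕ}
    {A B : Matrix (Fin a) (Fin b) (Operand ι)} {A' B' : Matrix (Fin a) (Fin b) K}
    (hA : A.Holds inp regs A') (hB : B.Holds inp regs B') :
    (entrywise .add A B).Sat inp regs (a * b) fun rs D => D.Holds inp rs (A' + B') :=
  sat_entrywise .add hA hB

theorem sat_entrywise_sub {regs : List K} {a b : ℕ}
    {A B : Matrix (Fin a) (Fin b) (Operand ι)} {A' B' : Matrix (Fin a) (Fin b) K}
    (hA : A.Holds inp regs A') (hB : B.Holds inp regs B') :
    (entrywise .sub A B).Sat inp regs (a * b) fun rs D => D.Holds inp rs (A' - B') :=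
  sat_entrywise .sub hA hB

end Comp

end Semantics

/-! ### Matrix multiplication by blocks -/

namespace Comp

section RingPrograms

variable {ι κ ο : Type} {K : Type*} [Field K] {inp : ι → K}

/-- An operand of a straight-line program, as an operand of a program that had `base` results when
it called the straight-line program, which has produced `c` results since. -/
def translate (g : κ → Operand ι) (base c : ℕ) : Operand κ → Operand ι
  | .zero => .zero
  | .one => .one
  | .input i => g i
  | .reg k => if k < c then .reg (base + k) else .zero

/-- The instructions of a straight-line program, followed by its outputs. -/
def embedCode (g : κ → Operand ι) (out : ο → Operand κ) (base : ℕ) :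
    List (ArithOp × Operand κ × Operand κ) → ℕ → FieldProgram ι (ο → Operand ι)
  | [], c => .done fun o => translate g base c (out o)
  | x :: l, c => .arith x.1 (translate g base c x.2.1) (translate g base c x.2.2)
      (embedCode g out base l (c + 1))

/-- Runs a straight-line program on the operands `g`. -/
def embed (p : RingProgram κ ο) (g : κ → Operand ι) : Comp ι (ο → Operand ι) :=
  fun n => embedCode g p.out n p.code 0

theorem holds_translate {g : κ → Operand ι} {v : κ → K} {regs res : List K}
    (hg : ∀ i, (g i).Holds inp regs (v i)) (x : Operand κ) :
    (translate g regs.length res.length x).Holds inp (regs ++ res) (x.eval v res) := by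
  cases x with
  | zero => exact Operand.holds_zero _
  | one => exact Operand.holds_one _
  | input i => exact (hg i).mono (List.prefix_append _ _)
  | reg k =>
    simp only [translate, Operand.eval]
    split_ifs with h
    · have := Operand.holds_reg (inp := inp) (regs ++ res) (k := regs.length + k) (by simp [h])
      simpa [List.getElem?_append_right] using this
    -- A dangling reference reads `0` in the straight-line program. In the host program the shifted
    -- register might be filled later, so the constant `0` replaces it.
    · have : res.getD k 0 = 0 := by simp [not_lt.mp h]
      rw [this]
      exact Operand.holds_zero _

theorem run_embedCode {g : κ → Operand ι} {v : κ → K} {regs : List K}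
    (hg : ∀ i, (g i).Holds inp regs (v i)) (out : ο → Operand κ) :
    ∀ (l : List (ArithOp × Operand κ × Operand κ)) (res : List K),
      ∃ r, (embedCode g out regs.length l res.length).run inp (regs ++ res) = some r ∧
        regs ++ res <+: r.regs ∧ r.ops = l.length ∧
        ∀ o, (r.out o).Holds inp r.regs ((out o).eval v
          (l.foldl (fun rs c => rs ++ [c.1.eval (c.2.1.eval v rs) (c.2.2.eval v rs)]) res))
  | [], res => ⟨_, rfl, List.prefix_rfl, rfl, fun o => holds_translate hg (out o)⟩
  | x :: l, res => by
    obtain ⟨r, h₁, h₂, h₃, h₄⟩ := run_embedCode hg out l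
      (res ++ [x.1.eval (x.2.1.eval v res) (x.2.2.eval v res)])
    refine ⟨r.tick, ?_, (List.prefix_append _ _).trans (List.append_assoc _ _ _ ▸ h₂), ?_, h₄⟩
    · rw [List.length_append, List.length_singleton, ← List.append_assoc] at h₁
      simp only [embedCode, FieldProgram.run, (holds_translate hg _).eval, h₁, Option.map_some]
    · simp [Outcome.tick, h₃]

theorem sat_embed (p : RingProgram κ ο) {g : κ → Operand ι} {v : κ → K} {regs : List K}
    (hg : ∀ i, (g i).Holds inp regs (v i)) :
    (embed p g).Sat inp regs p.cost fun rs z => ∀ o, (z o).Holds inp rs (p.eval v o) := by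
  obtain ⟨r, h₁, h₂, h₃, h₄⟩ := run_embedCode hg p.out p.code []
  rw [List.append_nil] at h₁ h₂
  exact ⟨r, h₁, h₂, h₃.le, h₄⟩

end RingPrograms

/-- A family of straight-line programs, meant to multiply square matrices of each size. -/
abbrev MulPrograms : Type := (n : ℕ) → RingProgram (TwoMatrices n n n n) (Fin n × Fin n)

/-- The programs `mm` multiply matrices over `K`. -/
def MulPrograms.Correct (mm : MulPrograms) (K : Type*) [Field K] : Prop :=
  ∀ n, 1 ≤ n → ∀ (A B : Matrix (Fin n) (Fin n) K) (i j : Fin n),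
    (mm n).eval (matrixInputs A B) (i, j) = (A * B) i j

variable {ι : Type} {K : Type*} [Field K] {inp : ι → K}

/-- The product of two square matrices. -/
def mulSquare (mm : MulPrograms) {n : ℕ} (A B : Matrix (Fin n) (Fin n) (Operand ι)) :
    Comp ι (Matrix (Fin n) (Fin n) (Operand ι)) :=
  embed (mm n) (Sum.elim (fun x => A x.1 x.2) fun x => B x.1 x.2) >>=
    fun z => pure fun i j => z (i, j)

theorem sat_mulSquare {mm : MulPrograms} (hmm : mm.Correct K) {n : ℕ} (hn : 1 ≤ n) {regs : List K}
    {A B : Matrix (Fin n) (Fin n) (Operand ι)} {A' B' : Matrix (Fin n) (Fin n) K}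
    (hA : A.Holds inp regs A') (hB : B.Holds inp regs B') :
    (mulSquare mm A B).Sat inp regs (mm n).cost fun rs D => D.Holds inp rs (A' * B') := by
  refine (sat_embed (mm n) (v := matrixInputs A' B') ?_).bind (T₂ := 0) fun rs z _ hz => ?_
  · rintro (x | x)
    exacts [hA _ _, hB _ _]
  · refine sat_pure fun i j => ?_
    rw [← hmm n hn]
    exact hz (i, j)

/-- The block at position `(x, y)` when a matrix is cut into blocks of size `n`, filled up with
`z`. -/
def _root_.Matrix.block {R : Type*} (z : R) (n : ℕ) {a b : ℕ} (A : Matrix (Fin a) (Fin b) R)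
    (x y : ℕ) : Matrix (Fin n) (Fin n) R :=
  fun i j => if h : n * x + i < a ∧ n * y + j < b then A ⟨_, h.1⟩ ⟨_, h.2⟩ else z

theorem _root_.Matrix.Holds.block {regs : List K} {a b : ℕ}
    {A : Matrix (Fin a) (Fin b) (Operand ι)} {A' : Matrix (Fin a) (Fin b) K}
    (hA : A.Holds inp regs A') (n x y : ℕ) :
    (A.block .zero n x y).Holds inp regs (A'.block 0 n x y) := by
  intro i j
  simp only [Matrix.block]
  split_ifs
  exacts [hA _ _, Operand.holds_zero _]

theorem sum_range_mul_eq {R : Type*} [AddCommMonoid R] (n : ℕ) (f : ℕ → R) : ∀ q : ℕ,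
    ∑ k ∈ Finset.range (n * q), f k = ∑ y ∈ Finset.range q, ∑ l : Fin n, f (n * y + l)
  | 0 => by simp
  | q + 1 => by
    rw [Finset.sum_range_succ, Nat.mul_succ, Finset.sum_range_add, sum_range_mul_eq n f q,
      Finset.sum_range (fun l => f (n * q + l))]

/-- Zero padding lengthens the inner sum from `b` to `n * (b / n + 1)` terms, a multiple of the
block size. Taking `b / n + 1` blocks avoids rounding up, at the price of a block of zeros when `n`
divides `b`. -/
theorem _root_.Matrix.mul_apply_eq_sum_block {R : Type*} [Ring R] {a b c n : ℕ} (hn : 1 ≤ n)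
    (A : Matrix (Fin a) (Fin b) R) (B : Matrix (Fin b) (Fin c) R) (i : Fin a) (j : Fin c) :
    (A * B) i j = ∑ y ∈ Finset.range (b / n + 1),
      (A.block 0 n (i / n) y * B.block 0 n y (j / n))
        ⟨i % n, Nat.mod_lt _ hn⟩ ⟨j % n, Nat.mod_lt _ hn⟩ := by
  let f : ℕ → R := fun k => if h : k < b then A i ⟨k, h⟩ * B ⟨k, h⟩ j else 0
  have h₁ : (A * B) i j = ∑ k ∈ Finset.range b, f k := by
    rw [Finset.sum_range, Matrix.mul_apply]
    exact Finset.sum_congr rfl fun k _ => by simp [f]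
  have h₂ : ∑ k ∈ Finset.range b, f k = ∑ k ∈ Finset.range (n * (b / n + 1)), f k := by
    refine Finset.sum_subset ?_ fun k _ hk => ?_
    · exact Finset.range_subset_range.2 (Nat.lt_mul_div_succ b hn).le
    · simp only [Finset.mem_range] at hk
      simp [f, hk]
  rw [h₁, h₂, sum_range_mul_eq]
  refine Finset.sum_congr rfl fun y _ => ?_
  rw [Matrix.mul_apply]
  refine Finset.sum_congr rfl fun l _ => ?_
  simp only [Matrix.block, Nat.div_add_mod, f, i.2, j.2, true_and, and_true]
  split_ifs <;> simp

/-- The sum of the products of the first `q` blocks in a row and a column of blocks. -/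
def mulBlocks (mm : MulPrograms) {n : ℕ} (A B : ℕ → Matrix (Fin n) (Fin n) (Operand ι)) :
    ℕ → Comp ι (Matrix (Fin n) (Fin n) (Operand ι))
  | 0 => pure fun _ _ => .zero
  | q + 1 => mulBlocks mm A B q >>= fun S => mulSquare mm (A q) (B q) >>= fun D =>
      entrywise .add S D

theorem sat_mulBlocks {mm : MulPrograms} (hmm : mm.Correct K) {n : ℕ} (hn : 1 ≤ n) {regs : List K}
    {A B : ℕ → Matrix (Fin n) (Fin n) (Operand ι)} {A' B' : ℕ → Matrix (Fin n) (Fin n) K}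
    (hA : ∀ y, (A y).Holds inp regs (A' y)) (hB : ∀ y, (B y).Holds inp regs (B' y)) :
    ∀ q, (mulBlocks mm A B q).Sat inp regs (q * ((mm n).cost + n * n)) fun rs D =>
      D.Holds inp rs (∑ y ∈ Finset.range q, A' y * B' y)
  | 0 => sat_pure fun _ _ => Operand.holds_zero _
  | q + 1 => by
    refine Sat.le (T := q * ((mm n).cost + n * n) + ((mm n).cost + n * n)) ?_
      (Nat.succ_mul _ _).ge
    refine (sat_mulBlocks hmm hn hA hB q).bind fun rs S h hS => ?_
    refine (sat_mulSquare hmm hn ((hA q).mono h) ((hB q).mono h)).bind fun rs' D h' hD => ?_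
    rw [Finset.sum_range_succ]
    exact sat_entrywise_add (hS.mono h') hD

/-- The product of two matrices, computed by cutting them into square blocks of size `n`. -/
def mulMatrix (mm : MulPrograms) (n : ℕ) (hn : 1 ≤ n) {a b c : ℕ}
    (A : Matrix (Fin a) (Fin b) (Operand ι)) (B : Matrix (Fin b) (Fin c) (Operand ι)) :
    Comp ι (Matrix (Fin a) (Fin c) (Operand ι)) :=
  forFin (a / n + 1) (fun x => forFin (c / n + 1) fun z =>
    mulBlocks mm (fun y => A.block .zero n x y) (fun y => B.block .zero n y z) (b / n + 1)) >>=
  fun D => pure fun i j => D ⟨i / n, Nat.lt_succ_of_le (Nat.div_le_div_right i.2.le)⟩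
    ⟨j / n, Nat.lt_succ_of_le (Nat.div_le_div_right j.2.le)⟩
    ⟨i % n, Nat.mod_lt _ hn⟩ ⟨j % n, Nat.mod_lt _ hn⟩

/-- The cost of `mulMatrix`. -/
def mulCost (mm : MulPrograms) (n a b c : ℕ) : ℕ :=
  (a / n + 1) * ((c / n + 1) * ((b / n + 1) * ((mm n).cost + n * n)))

theorem sat_mulMatrix {mm : MulPrograms} (hmm : mm.Correct K) {n : ℕ} (hn : 1 ≤ n) {a b c : ℕ}
    {regs : List K} {A : Matrix (Fin a) (Fin b) (Operand ι)}
    {B : Matrix (Fin b) (Fin c) (Operand ι)}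
    {A' : Matrix (Fin a) (Fin b) K} {B' : Matrix (Fin b) (Fin c) K}
    (hA : A.Holds inp regs A') (hB : B.Holds inp regs B') :
    (mulMatrix mm n hn A B).Sat inp regs (mulCost mm n a b c) fun rs D =>
      D.Holds inp rs (A' * B') := by
  let P : ℕ → ℕ → Matrix (Fin n) (Fin n) K := fun x z =>
    ∑ y ∈ Finset.range (b / n + 1), A'.block 0 n x y * B'.block 0 n y z
  refine Sat.bind (T₂ := 0) (Q₁ := fun rs D => ∀ x z, (D x z).Holds inp rs (P x z))
    (sat_forFin (Q := fun x rs (D : Fin (c / n + 1) → Matrix (Fin n) (Fin n) (Operand ι)) =>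
      ∀ z, (D z).Holds inp rs (P x z))
      (fun x rs rs' D h hD z => (hD z).mono h) fun x rs h => ?_) fun rs D _ hD => ?_
  · exact sat_forFin (Q := fun z rs (D : Matrix (Fin n) (Fin n) (Operand ι)) =>
      D.Holds inp rs (P x z)) (fun z rs rs' D h hD => hD.mono h) fun z rs' h' =>
      sat_mulBlocks hmm hn (fun y => (hA.mono (h.trans h')).block n x y)
        (fun y => (hB.mono (h.trans h')).block n y z) _
  · refine sat_pure fun i j => ?_
    rw [Matrix.mul_apply_eq_sum_block hn]
    have := hD ⟨i / n, Nat.lt_succ_of_le (Nat.div_le_div_right i.2.le)⟩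
      ⟨j / n, Nat.lt_succ_of_le (Nat.div_le_div_right j.2.le)⟩
      ⟨i % n, Nat.mod_lt _ hn⟩ ⟨j % n, Nat.mod_lt _ hn⟩
    simpa [P, Matrix.sum_apply] using this

end Comp

/-! ### Row rank profiles -/

section RankInverse

variable {K : Type*} [Field K]

/-- `G` is an inner inverse of `A` that exhibits `I` as the row rank profile of `A`: the rows of
`A` with index in `I` are independent, and every other row is a combination of those before it. -/
structure Matrix.IsRankInverse {n c : ℕ} (A : Matrix (Fin n) (Fin c) K) (I : Finset (Fin n))
    (G : Matrix (Fin c) (Fin n) K) : Prop where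
  mul_mul : A * G * A = A
  col_eq_zero : ∀ j, j ∉ I → ∀ i, G i j = 0
  unit : ∀ i ∈ I, ∀ j, (A * G) i j = if i = j then 1 else 0
  lower : ∀ i j, i < j → (A * G) i j = 0

/-- The elements of `Fin (a + b)` that come from two sets. -/
def Fin.appendFinset {a b : ℕ} (I : Finset (Fin a)) (J : Finset (Fin b)) : Finset (Fin (a + b)) :=
  I.map (Fin.castAddEmb b) ∪ J.map (Fin.natAddEmb a)

theorem Fin.castAdd_mem_appendFinset {a b : ℕ} {I : Finset (Fin a)} {J : Finset (Fin b)}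
    {i : Fin a} : Fin.castAdd b i ∈ Fin.appendFinset I J ↔ i ∈ I := by
  simp only [appendFinset, Finset.mem_union, Finset.mem_map, Fin.castAddEmb_apply,
    Fin.natAddEmb_apply]
  constructor
  · rintro (⟨k, hk, h⟩ | ⟨k, hk, h⟩)
    · rwa [← Fin.castAdd_injective _ _ h]
    · have := congrArg Fin.val h
      simp at this
      omega
  · exact fun h => Or.inl ⟨i, h, rfl⟩

theorem Fin.natAdd_mem_appendFinset {a b : ℕ} {I : Finset (Fin a)} {J : Finset (Fin b)}
    {j : Fin b} : Fin.natAdd a j ∈ Fin.appendFinset I J ↔ j ∈ J := by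
  simp only [appendFinset, Finset.mem_union, Finset.mem_map, Fin.castAddEmb_apply,
    Fin.natAddEmb_apply]
  constructor
  · rintro (⟨k, hk, h⟩ | ⟨k, hk, h⟩)
    · have := congrArg Fin.val h
      simp at this
      omega
    · rwa [← Fin.natAdd_injective _ _ h]
  · exact fun h => Or.inr ⟨j, h, rfl⟩

/-- The Schur complement `A₂ - A₂ G A₁` is `A₂` with the rows of `A₁` eliminated, so its profile is
that of the lower rows modulo the upper ones. The choice of `R` gives `A₁ R = 0`, and `L` corrects
`G` so that the product with `A` is the block matrix with rows `(A₁ G, 0)` and `(A₂ G - X A₂ G, X)`,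
where `X` is the Schur complement times `H`. All four properties are read off from these blocks. -/
theorem Matrix.IsRankInverse.append {a b c : ℕ} {A : Matrix (Fin (a + b)) (Fin c) K}
    {A₁ : Matrix (Fin a) (Fin c) K} {A₂ : Matrix (Fin b) (Fin c) K}
    (hA₁ : A₁ = A.submatrix (Fin.castAdd b) id) (hA₂ : A₂ = A.submatrix (Fin.natAdd a) id)
    {I : Finset (Fin a)} {J : Finset (Fin b)} {G : Matrix (Fin c) (Fin a) K}
    {H : Matrix (Fin c) (Fin b) K} (h₁ : A₁.IsRankInverse I G)
    (h₂ : (A₂ - A₂ * G * A₁).IsRankInverse J H) {L : Matrix (Fin c) (Fin a) K}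
    {R : Matrix (Fin c) (Fin b) K} (hR : R = H - G * (A₁ * H)) (hL : L = G - R * (A₂ * G)) :
    A.IsRankInverse (Fin.appendFinset I J) (Matrix.of fun i => Fin.append (L i) (R i)) := by
  set X := (A₂ - A₂ * G * A₁) * H with hX
  have hGc : ∀ j, j ∉ I → ∀ (d : ℕ) (B : Matrix (Fin d) (Fin c) K) i, (B * G) i j = 0 := by
    intro j hj d B i
    simp [Matrix.mul_apply, h₁.col_eq_zero j hj]
  have e₁ : A₁ * R = 0 := by
    rw [hR, Matrix.mul_sub, ← Matrix.mul_assoc, ← Matrix.mul_assoc, h₁.mul_mul, sub_self]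
  have e₂ : A₁ * L = A₁ * G := by
    rw [hL, Matrix.mul_sub, ← Matrix.mul_assoc A₁ R, e₁, Matrix.zero_mul, sub_zero]
  have e₃ : A₂ * R = X := by
    rw [hR, hX, Matrix.mul_sub, Matrix.sub_mul]
    simp only [Matrix.mul_assoc]
  have e₄ : A₂ * L = A₂ * G - X * (A₂ * G) := by
    rw [hL, Matrix.mul_sub, ← Matrix.mul_assoc A₂ R, e₃]
  let Z : Matrix (Fin c) (Fin (a + b)) K := Matrix.of fun i => Fin.append (L i) (R i)
  have f₁ : ∀ i j, (A * Z) (Fin.castAdd b i) (Fin.castAdd b j) = (A₁ * G) i j := by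
    intro i j
    rw [← e₂]
    simp [Matrix.mul_apply, Z, hA₁]
  have f₂ : ∀ i j, (A * Z) (Fin.castAdd b i) (Fin.natAdd a j) = 0 := by
    intro i j
    have := congrFun (congrFun e₁ i) j
    simpa [Matrix.mul_apply, Z, hA₁] using this
  have f₃ : ∀ i j, (A * Z) (Fin.natAdd a i) (Fin.castAdd b j) = (A₂ * G - X * (A₂ * G)) i j := by
    intro i j
    rw [← e₄]
    simp [Matrix.mul_apply, Z, hA₂]
  have f₄ : ∀ i j, (A * Z) (Fin.natAdd a i) (Fin.natAdd a j) = X i j := by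
    intro i j
    rw [← e₃]
    simp [Matrix.mul_apply, Z, hA₂]
  have hXunit : ∀ i ∈ J, ∀ j, X i j = if i = j then 1 else 0 := h₂.unit
  refine ⟨?_, fun j => ?_, fun i => ?_, fun i j => ?_⟩
  · change A * Z * A = A
    ext i j
    rw [Matrix.mul_apply, Fin.sum_univ_add]
    induction i using Fin.addCases with
    | left i =>
      have := congrFun (congrFun h₁.mul_mul i) j
      rw [Matrix.mul_apply] at this
      simp only [f₁, f₂, zero_mul, Finset.sum_const_zero, add_zero]
      simpa [hA₁] using this
    | right i =>
      -- The left side is `A₂ G A₁ + X (A₂ - A₂ G A₁)`, and `X` fixes the Schur complement because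
      -- `H` is an inner inverse of it.
      have e₅ : (A₂ * G - X * (A₂ * G)) * A₁ + X * A₂ = A₂ := by
        have := h₂.mul_mul
        rw [← hX, Matrix.mul_sub] at this
        rw [Matrix.sub_mul, Matrix.mul_assoc X]
        rw [sub_eq_sub_iff_add_eq_add] at this
        rw [sub_add_eq_add_sub, add_comm, this, add_sub_cancel_right]
      have := congrFun (congrFun e₅ i) j
      rw [Matrix.add_apply, Matrix.mul_apply, Matrix.mul_apply] at this
      simp only [f₃, f₄]
      simpa [hA₁, hA₂] using this
  · induction j using Fin.addCases with
    | left j =>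
      rw [Fin.castAdd_mem_appendFinset]
      intro hj i
      have h' : (R * (A₂ * G)) i j = 0 := by
        rw [← Matrix.mul_assoc]
        exact hGc j hj _ _ _
      simp [hL, h', h₁.col_eq_zero j hj]
    | right j =>
      rw [Fin.natAdd_mem_appendFinset]
      intro hj i
      have h' : (G * (A₁ * H)) i j = 0 := by
        simp [← Matrix.mul_assoc, Matrix.mul_apply (M := G * A₁), h₂.col_eq_zero j hj]
      simp [hR, h', h₂.col_eq_zero j hj]
  · change i ∈ _ → ∀ j, (A * Z) i j = _
    induction i using Fin.addCases with
    | left i =>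
      rw [Fin.castAdd_mem_appendFinset]
      intro hi j
      induction j using Fin.addCases with
      | left j => rw [f₁, h₁.unit i hi]; simp
      | right j =>
        rw [f₂, if_neg]
        intro h
        have := congrArg Fin.val h
        simp at this
        omega
    | right i =>
      rw [Fin.natAdd_mem_appendFinset]
      intro hi j
      induction j using Fin.addCases with
      | left j =>
        have e₅ : (X * (A₂ * G)) i j = (A₂ * G) i j := by
          rw [Matrix.mul_apply]
          simp [hXunit i hi]
        rw [f₃, if_neg, Matrix.sub_apply, e₅, sub_self]
        intro h
        have := congrArg Fin.val h
        simp at this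
        omega
      | right j => rw [f₄, hXunit i hi]; simp
  · change i < j → (A * Z) i j = 0
    intro hij
    induction i using Fin.addCases with
    | left i =>
      induction j using Fin.addCases with
      | left j => rw [f₁]; exact h₁.lower i j (by rw [Fin.lt_def] at hij ⊢; simpa using hij)
      | right j => exact f₂ i j
    | right i =>
      induction j using Fin.addCases with
      | left j =>
        rw [Fin.lt_def] at hij
        simp at hij
        omega
      | right j => rw [f₄]; exact h₂.lower i j (by simpa using hij)

theorem Matrix.isRankInverse_zero {n c : ℕ} {A : Matrix (Fin n) (Fin c) K} (hA : A = 0) :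
    A.IsRankInverse ∅ 0 := by
  subst hA
  constructor <;> simp

theorem Matrix.isRankInverse_single {c : ℕ} {A : Matrix (Fin 1) (Fin c) K} {l : Fin c}
    (hl : A 0 l ≠ 0) :
    A.IsRankInverse Finset.univ (Matrix.of fun i _ => if i = l then 1 / A 0 l else 0) := by
  have h : A * (Matrix.of fun i _ => if i = l then 1 / A 0 l else 0) =
      (1 : Matrix _ (Fin 1) K) := by
    ext i j
    rw [Subsingleton.elim i 0, Subsingleton.elim j 0]
    simp [Matrix.mul_apply, hl]
  refine ⟨by rw [h, Matrix.one_mul], by simp, fun i _ j => by rw [h, Matrix.one_apply], ?_⟩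
  intro i j hij
  omega

/-- The row rank profile consists of the rows that are not combinations of earlier ones. -/
theorem Matrix.IsRankInverse.mem_iff {n c : ℕ} {A : Matrix (Fin n) (Fin c) K} {I : Finset (Fin n)}
    {G : Matrix (Fin c) (Fin n) K} (h : A.IsRankInverse I G) (i : Fin n) :
    i ∈ I ↔ A i ∉ Submodule.span K (A '' {j | j < i}) := by
  constructor
  · intro hi hspan
    -- The functional `v ↦ (v G) i` kills the earlier rows, as `A G` is lower triangular, but takes
    -- the value `1` at row `i`.
    have hle : Submodule.span K (A '' {j | j < i}) ≤
        LinearMap.ker ((LinearMap.proj i).comp (Matrix.vecMulLinear G) : (Fin c → K) →ₗ[K] K) := by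
      rw [Submodule.span_le]
      rintro _ ⟨j, hj, rfl⟩
      exact h.lower j i hj
    have h₀ : (A * G) i i = 0 := hle hspan
    simp [h.unit i hi] at h₀
  · contrapose!
    intro hi
    -- Only `k < i` contributes: triangularity removes `k > i`, and column `i` of `G` vanishes.
    have h₁ : A i = ∑ k, (A * G) i k • A k := by
      ext j
      conv_lhs => rw [← h.mul_mul]
      rw [Matrix.mul_apply]
      simp
    rw [h₁]
    refine Submodule.sum_mem _ fun k _ => ?_
    rcases lt_trichotomy k i with hk | rfl | hk
    · exact Submodule.smul_mem _ _ (Submodule.subset_span ⟨k, hk, rfl⟩)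
    · have : (A * G) k k = 0 := by simp [Matrix.mul_apply, h.col_eq_zero k hi]
      simp [this]
    · simp [h.lower i k hk]

/-- Coordinates of a combination of the rows of `A` are obtained by multiplying by `G`. -/
theorem Matrix.IsRankInverse.vecMul_vecMul {n c : ℕ} {A : Matrix (Fin n) (Fin c) K}
    {I : Finset (Fin n)} {G : Matrix (Fin c) (Fin n) K} (h : A.IsRankInverse I G) {v : Fin c → K}
    (hv : v ∈ Submodule.span K (Set.range A)) : Matrix.vecMul (Matrix.vecMul v G) A = v := by
  have hle : Submodule.span K (Set.range A) ≤
      LinearMap.eqLocus (Matrix.vecMulLinear (G * A)) LinearMap.id := by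
    rw [Submodule.span_le]
    rintro _ ⟨j, rfl⟩
    change Matrix.vecMul (A j) (G * A) = A j
    have := congrFun h.mul_mul j
    rwa [Matrix.mul_assoc] at this
  have := hle hv
  rwa [Matrix.vecMul_vecMul]

end RankInverse

/-! ### Row rank profiles by divide and conquer -/

namespace Comp

variable {ι : Type} {K : Type*} [Field K] {inp : ι → K}

theorem _root_.Matrix.Holds.append {a b c : ℕ} {regs : List K}
    {L : Matrix (Fin c) (Fin a) (Operand ι)} {R : Matrix (Fin c) (Fin b) (Operand ι)}
    {L' : Matrix (Fin c) (Fin a) K} {R' : Matrix (Fin c) (Fin b) K}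
    (hL : L.Holds inp regs L') (hR : R.Holds inp regs R') :
    Matrix.Holds inp regs (fun i => Fin.append (L i) (R i))
      (Matrix.of fun i => Fin.append (L' i) (R' i)) := by
  intro i j
  induction j using Fin.addCases with
  | left j => simpa using hL i j
  | right j => simpa using hR i j

/-- Looks for the first nonzero element of a list. -/
def findNonzero {κ : Type} (x : κ → Operand ι) : List κ → Comp ι (Option κ)
  | [] => pure none
  | k :: l => isZero (x k) >>= fun b => if b then findNonzero x l else pure (some k)

theorem sat_findNonzero {κ : Type} {x : κ → Operand ι} {v : κ → K} : ∀ {l : List κ}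
    {regs : List K} (_ : ∀ k, (x k).Holds inp regs (v k)),
    (findNonzero x l).Sat inp regs l.length fun _ o =>
      match o with
      | none => ∀ k ∈ l, v k = 0
      | some k => v k ≠ 0
  | [], _, _ => sat_pure (by simp)
  | k :: l, regs, hx => by
    refine Sat.le (T := 1 + l.length) ?_ (by simp [add_comm])
    refine (sat_isZero (hx k)).bind fun rs b h hb => ?_
    cases b with
    | true =>
      refine (sat_findNonzero (l := l) fun k => (hx k).mono h).mono le_rfl ?_
      rintro rs' (_ | k') _ h'
      · have := hb.1 rfl
        simpa [this] using h'
      · exact h'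
    | false => exact sat_pure (by simpa using hb)

/-- The power `2 ^ k`, defined by doubling. -/
def dbl : ℕ → ℕ
  | 0 => 1
  | k + 1 => dbl k + dbl k

theorem dbl_eq (k : ℕ) : dbl k = 2 ^ k := by
  induction k with
  | zero => rfl
  | succ k ih => rw [dbl, ih, pow_succ, mul_two]

theorem one_le_dbl (k : ℕ) : 1 ≤ dbl k := by
  rw [dbl_eq]
  exact Nat.one_le_two_pow

/-- Computes the row rank profile of a matrix with `2 ^ k` rows, and a matrix that exhibits it. -/
def rankInverse (mm : MulPrograms) {c : ℕ} : (k : ℕ) → Matrix (Fin (dbl k)) (Fin c) (Operand ι) →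
    Comp ι (Finset (Fin (dbl k)) × Matrix (Fin c) (Fin (dbl k)) (Operand ι))
  | 0, A => findNonzero (A (0 : Fin 1)) (List.finRange c) >>= fun o =>
      match o with
      | none => pure (∅, fun _ _ => .zero)
      | some l => div .one (A (0 : Fin 1) l) >>= fun z =>
          pure (Finset.univ, fun i _ => if i = l then z else .zero)
  | k + 1, A =>
      rankInverse mm k (A.submatrix (Fin.castAdd _) id) >>= fun x =>
      mulMatrix mm (dbl k) (one_le_dbl k) (A.submatrix (Fin.natAdd _) id) x.2 >>= fun W =>
      mulMatrix mm (dbl k) (one_le_dbl k) W (A.submatrix (Fin.castAdd _) id) >>= fun V =>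
      entrywise .sub (A.submatrix (Fin.natAdd _) id) V >>= fun B =>
      rankInverse mm k B >>= fun y =>
      mulMatrix mm (dbl k) (one_le_dbl k) (A.submatrix (Fin.castAdd _) id) y.2 >>= fun U =>
      mulMatrix mm (dbl k) (one_le_dbl k) x.2 U >>= fun U' =>
      entrywise .sub y.2 U' >>= fun R =>
      mulMatrix mm (dbl k) (one_le_dbl k) R W >>= fun L' =>
      entrywise .sub x.2 L' >>= fun L =>
      pure (Fin.appendFinset x.1 y.1, fun i => Fin.append (L i) (R i))

/-- The cost of `rankInverse`. -/
def rankCost (mm : MulPrograms) (c : ℕ) : ℕ → ℕ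
  | 0 => c + 1
  | k + 1 => rankCost mm c k + (mulCost mm (dbl k) (dbl k) c (dbl k) +
      (mulCost mm (dbl k) (dbl k) (dbl k) c + (dbl k * c + (rankCost mm c k +
      (mulCost mm (dbl k) (dbl k) c (dbl k) + (mulCost mm (dbl k) c (dbl k) (dbl k) +
      (c * dbl k + (mulCost mm (dbl k) c (dbl k) (dbl k) + c * dbl k))))))))

theorem sat_rankInverse {mm : MulPrograms} (hmm : mm.Correct K) {c : ℕ} : ∀ (k : ℕ)
    {regs : List K} {A : Matrix (Fin (dbl k)) (Fin c) (Operand ι)}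
    {A' : Matrix (Fin (dbl k)) (Fin c) K} (_ : A.Holds inp regs A'),
    (rankInverse mm k A).Sat inp regs (rankCost mm c k) fun rs x =>
      ∃ G : Matrix (Fin c) (Fin (dbl k)) K, x.2.Holds inp rs G ∧ A'.IsRankInverse x.1 G
  | 0, regs, A, A', hA => by
    refine Sat.bind (T₂ := 1) (T₁ := c)
      ((sat_findNonzero (l := List.finRange c) (hA (0 : Fin 1))).le (by simp)) ?_
    rintro rs (_ | l) h ho
    · refine sat_pure ⟨0, fun _ _ => Operand.holds_zero _, Matrix.isRankInverse_zero ?_⟩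
      ext i j
      rw [show i = (0 : Fin 1) from Subsingleton.elim (α := Fin 1) i 0]
      exact ho j (List.mem_finRange j)
    · refine Sat.bind (T₁ := 1) (T₂ := 0)
        (sat_div (Operand.holds_one _) ((hA (0 : Fin 1) l).mono h) ho) fun rs' z h' hz => ?_
      refine sat_pure ⟨_, fun i j => ?_, Matrix.isRankInverse_single ho⟩
      change Operand.Holds inp rs' (if i = l then z else .zero) (if i = l then _ else 0)
      split_ifs
      exacts [hz, Operand.holds_zero _]
  | k + 1, regs, A, A', hA => by
    have hA₁ : (A.submatrix (Fin.castAdd (dbl k)) id).Holds inp regs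
        (A'.submatrix (Fin.castAdd (dbl k)) id) := fun i j => hA _ _
    have hA₂ : (A.submatrix (Fin.natAdd (dbl k)) id).Holds inp regs
        (A'.submatrix (Fin.natAdd (dbl k)) id) := fun i j => hA _ _
    refine (sat_rankInverse hmm k hA₁).bind ?_
    rintro r₁ x h₁ ⟨G, hG, hGA⟩
    refine (sat_mulMatrix hmm _ (hA₂.mono h₁) hG).bind fun r₂ W h₂ hW => ?_
    refine (sat_mulMatrix hmm _ hW (hA₁.mono (h₁.trans h₂))).bind fun r₃ V h₃ hV => ?_
    refine (sat_entrywise_sub (hA₂.mono (h₁.trans (h₂.trans h₃))) hV).bind fun r₄ B h₄ hB => ?_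
    refine (sat_rankInverse hmm k hB).bind ?_
    rintro r₅ y h₅ ⟨H, hH, hHA⟩
    have h₂₅ := h₂.trans (h₃.trans (h₄.trans h₅))
    refine (sat_mulMatrix hmm _ (hA₁.mono (h₁.trans h₂₅)) hH).bind fun r₆ U h₆ hU => ?_
    refine (sat_mulMatrix hmm _ (hG.mono (h₂₅.trans h₆)) hU).bind fun r₇ U' h₇ hU' => ?_
    refine (sat_entrywise_sub (hH.mono (h₆.trans h₇)) hU').bind fun r₈ R h₈ hR => ?_
    have h₃₈ := h₃.trans (h₄.trans (h₅.trans (h₆.trans (h₇.trans h₈))))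
    refine (sat_mulMatrix hmm _ hR (hW.mono h₃₈)).bind fun r₉ L' h₉ hL' => ?_
    refine Sat.bind (T₂ := 0) (sat_entrywise_sub (hG.mono (h₂.trans (h₃₈.trans h₉))) hL')
      fun r L h₀ hL => ?_
    exact sat_pure ⟨_, Matrix.Holds.append hL (hR.mono (h₉.trans h₀)),
      Matrix.IsRankInverse.append rfl rfl hGA hHA rfl rfl⟩

end Comp

/-! ### Elements of a family outside the span of their predecessors -/

section Standard

variable {μ o V : Type*} [LinearOrder o] (K : Type*) [Field K] [AddCommGroup V] [Module K V]
  (f : μ → o) (v : μ → V)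

/-- `v x` is not a combination of the `v y` with `y ∈ T` before `x` in the order given by `f`. -/
def IsStandard (T : Set μ) (x : μ) : Prop :=
  v x ∉ Submodule.span K (v '' {y | y ∈ T ∧ f y < f x})

variable {K f v}

theorem mem_span_image_mono {A B : Set μ} {w : V}
    (hw : w ∈ Submodule.span K (v '' A)) (h : ∀ y ∈ A, y ∈ B) : w ∈ Submodule.span K (v '' B) :=
  Submodule.span_mono (Set.image_mono h) hw

theorem IsStandard.anti {T T' : Set μ} (h : T' ⊆ T) {x : μ} (hx : IsStandard K f v T x) :
    IsStandard K f v T' x :=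
  fun h' => hx (mem_span_image_mono h' fun _ hy => ⟨h hy.1, hy.2⟩)

/-- In a nontrivial relation, the largest element with a nonzero coefficient would be a combination
of smaller ones, hence not standard. -/
theorem eq_zero_of_sum_smul_eq_zero (hf : Function.Injective f) {T : Set μ} {S : Finset μ}
    (hST : ↑S ⊆ T) {g : μ → K} (hg : ∑ x ∈ S, g x • v x = 0)
    (hS : ∀ x ∈ S, g x ≠ 0 → IsStandard K f v T x) : ∀ x ∈ S, g x = 0 := by
  classical
  by_contra! h
  obtain ⟨x₀, hx₀, hgx₀⟩ := h
  obtain ⟨x, hx, hmax⟩ := (S.filter (g · ≠ 0)).exists_max_image f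
    ⟨x₀, Finset.mem_filter.2 ⟨hx₀, hgx₀⟩⟩
  rw [Finset.mem_filter] at hx
  refine hS x hx.1 hx.2 ?_
  rw [← Finset.add_sum_erase _ _ hx.1, add_eq_zero_iff_eq_neg] at hg
  have h₁ : v x = (g x)⁻¹ • -∑ y ∈ S.erase x, g y • v y := by
    rw [← hg, smul_smul, inv_mul_cancel₀ hx.2, one_smul]
  rw [h₁]
  refine Submodule.smul_mem _ _ (Submodule.neg_mem _ (Submodule.sum_mem _ fun y hy => ?_))
  rw [Finset.mem_erase] at hy
  by_cases hgy : g y = 0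
  · simp [hgy]
  · refine Submodule.smul_mem _ _ (Submodule.subset_span ⟨y, ⟨hST hy.2, ?_⟩, rfl⟩)
    exact lt_of_le_of_ne (hmax y (Finset.mem_filter.2 ⟨hy.2, hgy⟩)) fun h => hy.1 (hf h)

theorem card_le_finrank_of_isStandard [FiniteDimensional K V] (hf : Function.Injective f)
    {T : Set μ} {S : Finset μ} (hST : ↑S ⊆ T) (hS : ∀ x ∈ S, IsStandard K f v T x) :
    S.card ≤ Module.finrank K V := by
  have h : LinearIndepOn K v (S : Set μ) := by
    rw [linearIndepOn_finset_iff]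
    exact fun g hg => eq_zero_of_sum_smul_eq_zero hf hST hg fun x hx _ => hS x hx
  have := LinearIndependent.fintype_card_le_finrank h
  simpa using this

/-- Nonstandard elements are replaced by strictly smaller ones until none is left; well-foundedness
ends the process. -/
theorem mem_span_isStandard [WellFoundedLT o] (T : Set μ) (x : μ) (hx : x ∈ T) :
    v x ∈ Submodule.span K (v '' {y | (y ∈ T ∧ IsStandard K f v T y) ∧ f y ≤ f x}) := by
  induction h : f x using WellFoundedLT.induction generalizing x with
  | ind a ih =>
    subst h
    by_cases hs : IsStandard K f v T x
    · exact Submodule.subset_span ⟨x, ⟨⟨hx, hs⟩, le_rfl⟩, rfl⟩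
    · refine (Submodule.span_le.2 ?_) (not_not.1 hs)
      rintro _ ⟨y, hy, rfl⟩
      exact mem_span_image_mono (ih (f y) hy.2 y hy.1 rfl)
        fun z hz => ⟨hz.1, hz.2.trans hy.2.le⟩

theorem mem_span_isStandard_lt [WellFoundedLT o] {T : Set μ} {x : μ}
    (hx : ¬ IsStandard K f v T x) :
    v x ∈ Submodule.span K (v '' {y | (y ∈ T ∧ IsStandard K f v T y) ∧ f y < f x}) := by
  refine (Submodule.span_le.2 ?_) (not_not.1 hx)
  rintro _ ⟨y, hy, rfl⟩
  exact mem_span_image_mono (mem_span_isStandard T y hy.1)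
        fun z hz => ⟨hz.1, hz.2.trans_lt hy.2⟩

/-- Elements in the span of their remaining predecessors can be left out. -/
theorem isStandard_iff_of_subset {T T' : Set μ} (hT : T' ⊆ T)
    (h : ∀ x ∈ T, x ∉ T' → v x ∈ Submodule.span K (v '' {y | y ∈ T' ∧ f y < f x})) (x : μ) :
    x ∈ T ∧ IsStandard K f v T x ↔ x ∈ T' ∧ IsStandard K f v T' x := by
  -- A predecessor of `x` that was left out is a combination of elements of `T'` that precede it,
  -- and so precede `x`.
  have hspan : Submodule.span K (v '' {y | y ∈ T ∧ f y < f x}) ≤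
      Submodule.span K (v '' {y | y ∈ T' ∧ f y < f x}) := by
    rw [Submodule.span_le]
    rintro _ ⟨y, hy, rfl⟩
    by_cases hyT : y ∈ T'
    · exact Submodule.subset_span ⟨y, ⟨hyT, hy.2⟩, rfl⟩
    · exact mem_span_image_mono (h y hy.1 hyT)
        fun z hz => ⟨hz.1, hz.2.trans hy.2⟩
  constructor
  · rintro ⟨h₁, h₂⟩
    refine ⟨?_, h₂.anti hT⟩
    by_contra hx
    exact (h₂.anti hT) (h x h₁ hx)
  · rintro ⟨h₁, h₂⟩
    exact ⟨hT h₁, fun h' => h₂ (hspan h')⟩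

end Standard

/-! ### The interpolation basis in Popov form -/

section Popov

variable {K : Type*} [Field K] {m σ : ℕ}

/-- The monomials `X ^ d e_i`, written `(i, d)`, are ordered by shifted degree, then position. -/
def monomialKey (s : Fin m → ℕ) (x : Fin m × ℕ) : ℕ ×ₗ Fin m := toLex (x.2 + s x.1, x.1)

theorem monomialKey_injective (s : Fin m → ℕ) : Function.Injective (monomialKey s) := by
  rintro ⟨i, d⟩ ⟨j, e⟩ h
  simp only [monomialKey, EmbeddingLike.apply_eq_iff_eq, Prod.mk.injEq] at h
  obtain ⟨h, rfl⟩ := h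
  simpa using h

theorem monomialKey_lt_iff {s : Fin m → ℕ} {x y : Fin m × ℕ} : monomialKey s x < monomialKey s y ↔
    x.2 + s x.1 < y.2 + s y.1 ∨ x.2 + s x.1 = y.2 + s y.1 ∧ x.1 < y.1 := by
  simp [monomialKey, Prod.Lex.toLex_lt_toLex]

theorem monomialKey_add_lt_iff {s : Fin m → ℕ} {i j : Fin m} {d e : ℕ} (k : ℕ) :
    monomialKey s (i, d + k) < monomialKey s (j, e + k) ↔
      monomialKey s (i, d) < monomialKey s (j, e) := by
  simp only [monomialKey_lt_iff]
  omega

/-- The vector `e_i M ^ d` of the monomial `X ^ d e_i`. -/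
def krylov (E : Matrix (Fin m) (Fin σ) K) (M : Matrix (Fin σ) (Fin σ) K) (x : Fin m × ℕ) :
    Fin σ → K :=
  Matrix.vecMul (E x.1) (M ^ x.2)

variable {E : Matrix (Fin m) (Fin σ) K} {M : Matrix (Fin σ) (Fin σ) K} {s : Fin m → ℕ}

theorem krylov_add (i : Fin m) (d k : ℕ) :
    krylov E M (i, d + k) = Matrix.vecMul (krylov E M (i, d)) (M ^ k) := by
  simp [krylov, pow_add]

theorem polyAct_eq_sum {p : Fin m → K[X]} {N : ℕ} (hN : ∀ i, (p i).natDegree < N) :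
    polyAct E M p =
      ∑ x ∈ Finset.univ ×ˢ Finset.range N, (p x.1).coeff x.2 • krylov E M x := by
  rw [polyAct, Finset.sum_product]
  refine Finset.sum_congr rfl fun i _ => ?_
  rw [Polynomial.aeval_eq_sum_range' (hN i), Matrix.vecMul_sum]
  simp [krylov, Matrix.vecMul_smul]

theorem exists_natDegree_lt (p : Fin m → K[X]) : ∃ N, ∀ i, (p i).natDegree < N :=
  ⟨(Finset.univ.sup fun i => (p i).natDegree) + 1, fun i =>
    Nat.lt_succ_of_le (Finset.le_sup (f := fun i => (p i).natDegree) (Finset.mem_univ i))⟩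

variable (s E M) in
/-- The monomial `x` is not congruent, modulo the interpolants, to a combination of smaller
monomials. -/
def IsStandardMonomial (x : Fin m × ℕ) : Prop :=
  IsStandard K (monomialKey s) (krylov E M) Set.univ x

/-- The vectors of the standard monomials are independent. This settles both the remainder of the
division and the uniqueness of the Popov form. -/
theorem eq_zero_of_coeff_isStandardMonomial {p : Fin m → K[X]} (hp : polyAct E M p = 0)
    (h : ∀ i d, (p i).coeff d ≠ 0 → IsStandardMonomial E M s (i, d)) : p = 0 := by
  obtain ⟨N, hN⟩ := exists_natDegree_lt p
  rw [polyAct_eq_sum hN] at hp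
  have h₀ := eq_zero_of_sum_smul_eq_zero (f := monomialKey s) (monomialKey_injective s)
    (Set.subset_univ _) hp fun x _ hx => h x.1 x.2 hx
  ext i d
  by_cases hd : d < N
  · exact h₀ (i, d) (by simp [hd])
  · exact Polynomial.coeff_eq_zero_of_natDegree_lt ((hN i).trans_le (not_lt.1 hd))

/-- Solving the relation given by the interpolant for its leading monomial expresses that vector
through smaller ones. -/
theorem not_isStandardMonomial_of_polyAct_eq_zero {p : Fin m → K[X]} (hp : polyAct E M p = 0)
    {i : Fin m} {d : ℕ} (hid : (p i).coeff d ≠ 0)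
    (h : ∀ j e, (p j).coeff e ≠ 0 → (j, e) = (i, d) ∨ monomialKey s (j, e) < monomialKey s (i, d)) :
    ¬ IsStandardMonomial E M s (i, d) := by
  obtain ⟨N, hN⟩ := exists_natDegree_lt p
  rw [polyAct_eq_sum hN, ← Finset.add_sum_erase _ _ (a := (i, d)),
    add_eq_zero_iff_eq_neg] at hp
  · refine not_not.2 ?_
    have h₁ : krylov E M (i, d) = ((p i).coeff d)⁻¹ • ((p i).coeff d • krylov E M (i, d)) := by
      rw [smul_smul, inv_mul_cancel₀ hid, one_smul]
    rw [h₁, hp]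
    refine Submodule.smul_mem _ _ (Submodule.neg_mem _ (Submodule.sum_mem _ fun y hy => ?_))
    rw [Finset.mem_erase] at hy
    by_cases hgy : (p y.1).coeff y.2 = 0
    · simp [hgy]
    · refine Submodule.smul_mem _ _ (Submodule.subset_span ⟨y, ⟨Set.mem_univ _, ?_⟩, rfl⟩)
      exact (h y.1 y.2 hgy).resolve_left hy.1
  · have := (Polynomial.le_natDegree_of_ne_zero hid).trans_lt (hN i)
    simp [this]

/-- Multiplication by `M` carries a combination of smaller monomials for degree `d` to one for
degree `d + 1`, since the order is invariant under `X`. -/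
theorem IsStandardMonomial.of_succ {i : Fin m} {d : ℕ}
    (h : IsStandardMonomial E M s (i, d + 1)) : IsStandardMonomial E M s (i, d) := by
  intro h'
  refine h ?_
  have := Submodule.mem_map_of_mem (f := Matrix.vecMulLinear M) h'
  rw [Submodule.map_span, Matrix.vecMulLinear_apply] at this
  have h₁ := krylov_add (E := E) (M := M) i d 1
  rw [pow_one] at h₁
  rw [← h₁] at this
  refine Submodule.span_mono ?_ this
  rintro _ ⟨_, ⟨⟨j, e⟩, he, rfl⟩, rfl⟩
  refine ⟨(j, e + 1), ⟨Set.mem_univ _, (monomialKey_add_lt_iff 1).2 he.2⟩, ?_⟩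
  rw [krylov_add, pow_one]
  rfl

/-- Reduce `X ^ d` modulo the minimal polynomial of `M`. The position is unchanged and the degree
does not grow, so for `d ≥ N` only smaller monomials are used, whatever the shift. -/
theorem krylov_mem_span_lt {N : ℕ} (hN : (minpoly K M).natDegree ≤ N) (i : Fin m) (d : ℕ) :
    krylov E M (i, d) ∈
      Submodule.span K (krylov E M '' {y | y.2 < N ∧ y.1 = i ∧ y.2 ≤ d}) := by
  by_cases hd : d < N
  · exact Submodule.subset_span ⟨(i, d), ⟨hd, rfl, le_rfl⟩, rfl⟩
  have hmonic := minpoly.monic (Matrix.isIntegral (R := K) M)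
  have h₁ : M ^ d = aeval M (X ^ d %ₘ minpoly K M) := by
    conv_lhs => rw [← aeval_X_pow (R := K) M, ← modByMonic_add_div (X ^ d) (minpoly K M)]
    simp
  rw [krylov, h₁, Polynomial.aeval_eq_sum_range, Matrix.vecMul_sum]
  refine Submodule.sum_mem _ fun k hk => ?_
  rw [Matrix.vecMul_smul]
  by_cases hc : (X ^ d %ₘ minpoly K M).coeff k = 0
  · simp [hc]
  refine Submodule.smul_mem _ _ (Submodule.subset_span ⟨(i, k), ?_, rfl⟩)
  have hk : k < N := by
    have h₂ := Polynomial.degree_modByMonic_lt (X ^ d) hmonic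
    have h₃ := Polynomial.le_degree_of_ne_zero hc
    have h₄ := h₃.trans_lt (h₂.trans_le Polynomial.degree_le_natDegree)
    exact lt_of_lt_of_le (by exact_mod_cast h₄) hN
  exact ⟨hk, rfl, hk.le.trans (not_lt.1 hd)⟩

theorem IsStandardMonomial.lt {N : ℕ} (hN : (minpoly K M).natDegree ≤ N) {x : Fin m × ℕ}
    (h : IsStandardMonomial E M s x) : x.2 < N := by
  by_contra hx
  refine h (mem_span_image_mono (krylov_mem_span_lt hN x.1 x.2) ?_)
  rintro ⟨i, d⟩ ⟨h₁, h₂, h₃⟩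
  refine ⟨Set.mem_univ _, ?_⟩
  simp only [monomialKey_lt_iff] at *
  subst h₂
  omega

/-- Monomials of large degree do not matter. -/
theorem isStandardMonomial_iff {N : ℕ} (hN : (minpoly K M).natDegree ≤ N) {x : Fin m × ℕ} :
    IsStandardMonomial E M s x ↔
      x ∈ {y : Fin m × ℕ | y.2 < N} ∧
        IsStandard K (monomialKey s) (krylov E M) {y | y.2 < N} x := by
  have := isStandard_iff_of_subset (K := K) (f := monomialKey s) (v := krylov E M)
    (Set.subset_univ {y : Fin m × ℕ | y.2 < N}) (fun x _ hx => ?_) x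
  · simpa [IsStandardMonomial] using this
  refine mem_span_image_mono (krylov_mem_span_lt hN x.1 x.2) ?_
  rintro ⟨i, d⟩ ⟨h₁, h₂, h₃⟩
  refine ⟨h₁, ?_⟩
  simp only [Set.mem_ofPred_eq, monomialKey_lt_iff] at *
  subst h₂
  omega

variable (s E M) in
-- At each position the standard degrees are closed downwards and bounded by the degree of the
-- minimal polynomial; `e i` is the first missing one.
theorem exists_pivotDegrees : ∃ e : Fin m → ℕ, (∀ i d, IsStandardMonomial E M s (i, d) ↔ d < e i) ∧
    ∀ i, e i ≤ (minpoly K M).natDegree := by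
  classical
  have hex : ∀ i, ∃ d, ¬ IsStandardMonomial E M s (i, d) := fun i =>
    ⟨_, fun h => lt_irrefl _ (h.lt (x := (i, (minpoly K M).natDegree)) le_rfl)⟩
  have hanti : ∀ i a b, a ≤ b → IsStandardMonomial E M s (i, b) →
      IsStandardMonomial E M s (i, a) := by
    intro i a b hab
    induction hab with
    | refl => exact id
    | step _ ih => exact fun h => ih h.of_succ
  refine ⟨fun i => Nat.find (hex i), fun i d => ⟨fun h => ?_, fun h => ?_⟩, fun i => ?_⟩
  · by_contra hd
    exact Nat.find_spec (hex i) (hanti i _ _ (not_lt.1 hd) h)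
  · exact not_not.1 (Nat.find_min (hex i) h)
  · refine Nat.find_min' (hex i) fun h => ?_
    exact lt_irrefl _ (h.lt (x := (i, (minpoly K M).natDegree)) le_rfl)

/-- In a combination of rows of a matrix whose diagonal entries dominate their columns, some
column shows the degree of the combination. -/
theorem exists_degree_vecMul_eq {Q : Matrix (Fin m) (Fin m) K[X]} (hQ₀ : ∀ j, Q j j ≠ 0)
    (hQ : ∀ i j, i ≠ j → (Q i j).degree < (Q j j).degree) {a : Fin m → K[X]} (ha : a ≠ 0) :
    ∃ j, a j ≠ 0 ∧ (∑ i, a i * Q i j).degree = (a j).degree + (Q j j).degree := by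
  obtain ⟨k, hk⟩ := Function.ne_iff.1 ha
  -- With `a j` of maximal degree, the term `a j * Q j j` strictly dominates every other term in
  -- column `j`.
  obtain ⟨j, -, hj⟩ := Finset.univ.exists_max_image (fun i => (a i).degree) ⟨k, Finset.mem_univ k⟩
  have haj : a j ≠ 0 := by
    intro h
    have := hj k (Finset.mem_univ k)
    rw [h, degree_zero, le_bot_iff, degree_eq_bot] at this
    exact hk this
  refine ⟨j, haj, ?_⟩
  rw [← Finset.add_sum_erase _ _ (Finset.mem_univ j), degree_add_eq_left_of_degree_lt, degree_mul]
  refine (degree_sum_le _ _).trans_lt ((Finset.sup_lt_iff ?_).2 fun i hi => ?_)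
  · rw [bot_lt_iff_ne_bot, Ne, degree_eq_bot]
    exact mul_ne_zero haj (hQ₀ j)
  · rw [Finset.mem_erase] at hi
    refine lt_of_le_of_lt (b := (a j * Q i j).degree) ?_ ?_
    · rw [degree_mul, degree_mul]
      exact add_le_add_left (hj i (Finset.mem_univ i)) _
    · rw [degree_mul, degree_mul]
      exact WithBot.add_lt_add_left (by rwa [Ne, degree_eq_bot]) (hQ i j hi.1)

theorem linearIndependent_of_degree_lt {Q : Matrix (Fin m) (Fin m) K[X]} (hQ₀ : ∀ j, Q j j ≠ 0)
    (hQ : ∀ i j, i ≠ j → (Q i j).degree < (Q j j).degree) :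
    LinearIndependent K[X] fun i => Q i := by
  rw [Fintype.linearIndependent_iff]
  intro a ha
  by_contra! h
  obtain ⟨j, hj, hdeg⟩ := exists_degree_vecMul_eq hQ₀ hQ (a := a)
    fun h' => h.elim fun i hi => hi (congrFun h' i)
  have := congrFun ha j
  simp only [Finset.sum_apply, Pi.smul_apply, smul_eq_mul, Pi.zero_apply] at this
  rw [this, degree_zero, ← degree_mul, eq_comm, degree_eq_bot] at hdeg
  exact mul_ne_zero hj (hQ₀ j) hdeg

theorem det_ne_zero_of_degree_lt {Q : Matrix (Fin m) (Fin m) K[X]} (hQ₀ : ∀ j, Q j j ≠ 0)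
    (hQ : ∀ i j, i ≠ j → (Q i j).degree < (Q j j).degree) : Q.det ≠ 0 := by
  intro h
  obtain ⟨a, ha, haQ⟩ := Matrix.exists_vecMul_eq_zero_iff.2 h
  refine ha (funext (Fintype.linearIndependent_iff.1 (linearIndependent_of_degree_lt hQ₀ hQ) a ?_))
  ext1 j
  simpa [Matrix.vecMul, dotProduct] using congrFun haQ j

theorem mem_of_coeff_ne_zero {W : Submodule K (Fin m → K[X])} {q : Fin m → K[X]}
    (h : ∀ i d, (q i).coeff d ≠ 0 → (Pi.single i (X ^ d) : Fin m → K[X]) ∈ W) : q ∈ W := by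
  rw [← Finset.univ_sum_single q]
  refine Submodule.sum_mem _ fun i _ => ?_
  have h₁ : (Pi.single i (q i) : Fin m → K[X]) =
      ∑ d ∈ (q i).support, (q i).coeff d • (Pi.single i (X ^ d) : Fin m → K[X]) := by
    conv_lhs => rw [(q i).as_sum_support_C_mul_X_pow]
    change LinearMap.single K (fun _ : Fin m => K[X]) i _ = _
    rw [map_sum]
    refine Finset.sum_congr rfl fun d _ => ?_
    rw [← smul_eq_C_mul, map_smul]
    rfl
  rw [h₁]
  exact Submodule.sum_mem _ fun d hd => Submodule.smul_mem _ _ (h i d (mem_support_iff.1 hd))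

end Popov

/-! ### From the relations to the Popov form and its uniqueness -/

section Popov

variable {K : Type*} [Field K] {m σ : ℕ}
  {E : Matrix (Fin m) (Fin σ) K} {M : Matrix (Fin σ) (Fin σ) K} {s : Fin m → ℕ}

/-- The degree bounds that say that the `s`-pivot of `p` is the monomial `X ^ e` at `i`. -/
theorem rowDeg_eq_of_coeff {p : Fin m → K[X]} {i : Fin m} {e : ℕ} (hi : (p i).degree = e)
    (h : ∀ j d, (p j).coeff d ≠ 0 →
      (j, d) = (i, e) ∨ monomialKey s (j, d) < monomialKey s (i, e)) :
    rowDeg s p = (e : WithBot ℕ) + (s i : WithBot ℕ) ∧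
      ∀ j, i < j → (p j).degree + (s j : WithBot ℕ) < (e : WithBot ℕ) + (s i : WithBot ℕ) := by
  have h₁ : ∀ j, p j ≠ 0 → (j, (p j).natDegree) = (i, e) ∨
      monomialKey s (j, (p j).natDegree) < monomialKey s (i, e) := fun j hj =>
    h j _ (by rwa [coeff_natDegree, Ne, leadingCoeff_eq_zero])
  constructor
  · refine le_antisymm (Finset.sup_le fun j _ => ?_) ?_
    · by_cases hj : p j = 0
      · simp [hj]
      rw [degree_eq_natDegree hj]
      rcases h₁ j hj with h₂ | h₂
      · simp only [Prod.mk.injEq] at h₂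
        rw [h₂.2, h₂.1]
      · rw [monomialKey_lt_iff] at h₂
        have : (p j).natDegree + s j ≤ e + s i := by
          rcases h₂ with h₂ | h₂
          exacts [h₂.le, h₂.1.le]
        exact_mod_cast this
    · rw [← hi]
      exact Finset.le_sup (f := fun j => (p j).degree + (s j : WithBot ℕ)) (Finset.mem_univ i)
  · intro j hij
    by_cases hj : p j = 0
    · rw [hj, degree_zero, WithBot.bot_add]
      exact WithBot.bot_lt_coe (e + s i)
    rw [degree_eq_natDegree hj]
    have h₂ := h₁ j hj
    rw [monomialKey_lt_iff, Prod.mk.injEq] at h₂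
    have : (p j).natDegree + s j < e + s i := by
      rcases h₂ with h₂ | h₂ | h₂
      · exact absurd h₂.1 hij.ne'
      · exact h₂
      · exact absurd h₂.2 hij.asymm
    exact_mod_cast this

theorem coeff_of_isPivotIndex {p : Fin m → K[X]} {i : Fin m} (hp : IsPivotIndex s p i) (j : Fin m)
    (d : ℕ) (hd : (p j).coeff d ≠ 0) : (j, d) = (i, (p i).natDegree) ∨
      monomialKey s (j, d) < monomialKey s (i, (p i).natDegree) := by
  obtain ⟨-, h₁, h₂⟩ := hp
  have hj : p j ≠ 0 := by
    rintro h
    simp [h] at hd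
  have hle : ∀ k, (p k).degree + (s k : WithBot ℕ) ≤ rowDeg s p := fun k =>
    Finset.le_sup (f := fun j => (p j).degree + (s j : WithBot ℕ)) (Finset.mem_univ k)
  have hi : p i ≠ 0 := by
    intro h
    have := hle j
    rw [← h₁, h, degree_zero, WithBot.bot_add, le_bot_iff, degree_eq_natDegree hj] at this
    exact WithBot.coe_ne_bot (a := (p j).natDegree + s j) this
  have h₃ := hle j
  have h₄ := h₂ j
  rw [← h₁, degree_eq_natDegree hj, degree_eq_natDegree hi] at h₃ h₄
  have h₅ : (p j).natDegree + s j ≤ (p i).natDegree + s i := by exact_mod_cast h₃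
  have h₆ : i < j → (p j).natDegree + s j ≠ (p i).natDegree + s i := by exact_mod_cast h₄
  have h₇ := le_natDegree_of_ne_zero hd
  rw [monomialKey_lt_iff, Prod.mk.injEq]
  rcases lt_trichotomy i j with h | rfl | h
  · have := h₆ h
    simp only
    omega
  · simp only [true_and]
    omega
  · simp only [h, and_true]
    omega

variable {e : Fin m → ℕ} {P : Matrix (Fin m) (Fin m) K[X]}

section

variable (he : ∀ i d, IsStandardMonomial E M s (i, d) ↔ d < e i)
  (hP : ∀ i j d, e j ≤ d → (P i j).coeff d = if i = j ∧ d = e j then 1 else 0)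

include hP

theorem natDegree_le_of_relations (i j : Fin m) : (P i j).natDegree ≤ e j := by
  rw [natDegree_le_iff_coeff_eq_zero]
  intro d hd
  rw [hP i j d hd.le, if_neg]
  omega

theorem monic_of_relations (i : Fin m) : (P i i).Monic :=
  monic_of_natDegree_le_of_coeff_eq_one _ (natDegree_le_of_relations hP i i)
    (by rw [hP i i _ le_rfl]; simp)

theorem degree_diag_of_relations (i : Fin m) : (P i i).degree = e i := by
  rw [degree_eq_natDegree (monic_of_relations hP i).ne_zero]
  congr 1
  exact natDegree_eq_of_le_of_coeff_ne_zero (natDegree_le_of_relations hP i i)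
    (by rw [hP i i _ le_rfl]; simp)

theorem degree_lt_of_relations (i j : Fin m) (hij : i ≠ j) : (P i j).degree < (P j j).degree := by
  rw [degree_diag_of_relations hP, degree_lt_iff_coeff_zero]
  intro d hd
  rw [hP i j d hd, if_neg]
  exact fun h => hij h.1

include he

/-- The column bounds `hP` alone locate the pivot: the leading monomial of row `i` is nonstandard,
and the only monomial of that row in a nonstandard degree is `X ^ (e i)` at `i`. -/
theorem coeff_of_relations (hact : ∀ i, polyAct E M (P i) = 0) (i j : Fin m) (d : ℕ)
    (hd : (P i j).coeff d ≠ 0) :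
    (j, d) = (i, e i) ∨ monomialKey s (j, d) < monomialKey s (i, e i) := by
  classical
  obtain ⟨N, hN⟩ := exists_natDegree_lt (P i)
  let F := (Finset.univ ×ˢ Finset.range N).filter fun x : Fin m × ℕ => (P i x.1).coeff x.2 ≠ 0
  have hF : ∀ j d, (P i j).coeff d ≠ 0 → (j, d) ∈ F := fun j d h =>
    Finset.mem_filter.2 ⟨by simpa using (le_natDegree_of_ne_zero h).trans_lt (hN j), h⟩
  obtain ⟨x, hx, hmax⟩ := F.exists_max_image (monomialKey s) ⟨_, hF j d hd⟩
  have hx₀ := (Finset.mem_filter.1 hx).2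
  have hle : ∀ j d, (P i j).coeff d ≠ 0 → (j, d) = x ∨ monomialKey s (j, d) < monomialKey s x :=
    fun j d h => (hmax _ (hF j d h)).lt_or_eq.symm.imp_left fun h => monomialKey_injective s h
  have h₁ := not_isStandardMonomial_of_polyAct_eq_zero (hact i) hx₀ hle
  rw [he, not_lt] at h₁
  have h₂ : i = x.1 ∧ x.2 = e x.1 := by
    by_contra h
    rw [hP _ _ _ h₁, if_neg h] at hx₀
    exact hx₀ rfl
  have h₃ : x = (i, e i) := Prod.ext h₂.1.symm (by rw [h₂.2, h₂.1])
  rw [← h₃]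
  exact hle j d hd

/-- Division with remainder: every vector is a combination of the rows plus a vector of `D`,
supported on standard monomials. For an interpolant the latter is again an interpolant, hence zero.
-/
theorem span_of_relations (hact : ∀ i, polyAct E M (P i) = 0) :
    Submodule.span K[X] (Set.range fun i => P i) = interpolants E M := by
  apply le_antisymm
  · rw [Submodule.span_le]
    rintro _ ⟨i, rfl⟩
    exact hact i
  intro p hp
  let N := Submodule.span K[X] (Set.range fun i => P i)
  let D : Submodule K (Fin m → K[X]) := Submodule.pi Set.univ fun j => degreeLT K (e j)
  have key : ∀ x : Fin m × ℕ, (Pi.single x.1 (X ^ x.2) : Fin m → K[X]) ∈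
      N.restrictScalars K ⊔ D := by
    intro x
    induction h : monomialKey s x using WellFoundedLT.induction generalizing x with
    | ind a ih =>
      subst h
      obtain ⟨j, d⟩ := x
      by_cases hd : d < e j
      · refine Submodule.mem_sup_right ?_
        rw [Submodule.mem_pi]
        intro k _
        rw [mem_degreeLT]
        by_cases hk : k = j
        · subst hk
          simpa using hd
        · simp only [Pi.single_eq_of_ne hk, degree_zero]
          exact WithBot.bot_lt_coe _
      · obtain ⟨k, rfl⟩ := Nat.exists_eq_add_of_le (not_lt.1 hd)
        have h₁ : (X ^ k : K[X]) • P j ∈ N.restrictScalars K :=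
          N.smul_mem _ (Submodule.subset_span ⟨j, rfl⟩)
        -- Subtracting the shifted row cancels the monomial itself and leaves only smaller ones, to
        -- which the induction applies.
        have h₂ : (Pi.single j (X ^ (e j + k)) : Fin m → K[X]) - (X ^ k : K[X]) • P j ∈
            N.restrictScalars K ⊔ D := by
          refine mem_of_coeff_ne_zero fun l t hlt => ?_
          refine ih _ ?_ (l, t) rfl
          have h₃ : ((Pi.single j (X ^ (e j + k)) : Fin m → K[X]) l).coeff t =
              if (l, t) = (j, e j + k) then 1 else 0 := by
            by_cases hl : l = j
            · subst hl
              simp [coeff_X_pow]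
            · simp [hl]
          simp only [Pi.sub_apply, Pi.smul_apply, smul_eq_mul, coeff_sub, h₃,
            coeff_X_pow_mul'] at hlt
          by_cases hkt : k ≤ t
          · obtain ⟨t, rfl⟩ := Nat.exists_eq_add_of_le' hkt
            rw [if_pos hkt, Nat.add_sub_cancel] at hlt
            rw [monomialKey_add_lt_iff]
            by_cases heq : (l, t) = (j, e j)
            · obtain ⟨rfl, rfl⟩ := Prod.mk.inj heq
              rw [if_pos rfl, hP _ _ _ le_rfl] at hlt
              simp at hlt
            · rw [if_neg (by simpa using heq), zero_sub, neg_ne_zero] at hlt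
              exact (coeff_of_relations he hP hact j l t hlt).resolve_left heq
          · rw [if_neg hkt, if_neg] at hlt
            · simp at hlt
            · intro h
              have := (Prod.mk.inj h).2
              omega
        have := Submodule.add_mem _ h₂ (Submodule.mem_sup_left h₁)
        rwa [sub_add_cancel] at this
  obtain ⟨q, hq, r, hr, rfl⟩ := Submodule.mem_sup.1
    (mem_of_coeff_ne_zero (q := p) fun i d _ => key (i, d))
  have hqN : q ∈ N := hq
  have hNle : N ≤ interpolants E M := by
    rw [Submodule.span_le]
    rintro _ ⟨i, rfl⟩
    exact hact i
  have hrI : r ∈ interpolants E M := by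
    have := (interpolants E M).sub_mem hp (hNle hqN)
    rwa [add_sub_cancel_left] at this
  have hr₀ : r = 0 := by
    refine eq_zero_of_coeff_isStandardMonomial (s := s) hrI fun i d hd => ?_
    rw [he]
    by_contra h
    have h₁ := Submodule.mem_pi.1 hr i (Set.mem_univ i)
    rw [mem_degreeLT, degree_lt_iff_coeff_zero] at h₁
    exact hd (h₁ d (not_lt.1 h))
  rw [hr₀, add_zero]
  exact hqN

theorem isInterpolationBasis_of_relations (hact : ∀ i, polyAct E M (P i) = 0) :
    IsInterpolationBasis E M P :=
  ⟨linearIndependent_of_degree_lt (fun j => (monic_of_relations hP j).ne_zero)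
    (degree_lt_of_relations hP), span_of_relations he hP hact⟩

theorem isPopov_of_relations (hact : ∀ i, polyAct E M (P i) = 0) : IsPopov s P := by
  refine ⟨det_ne_zero_of_degree_lt (fun j => (monic_of_relations hP j).ne_zero)
    (degree_lt_of_relations hP), fun i => ⟨⟨fun h => ?_, ?_, fun j hj => ?_⟩,
      monic_of_relations hP i⟩, degree_lt_of_relations hP⟩
  · exact (monic_of_relations hP i).ne_zero (congrFun h i)
  · rw [(rowDeg_eq_of_coeff (degree_diag_of_relations hP i) (coeff_of_relations he hP hact i)).1,
      degree_diag_of_relations hP]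
  · obtain ⟨h₁, h₂⟩ :=
      rowDeg_eq_of_coeff (degree_diag_of_relations hP i) (coeff_of_relations he hP hact i)
    rw [h₁]
    exact (h₂ j hj).ne

/-- The pivot is the last place where the row degree is attained, so the leading matrix is lower
triangular, with ones on the diagonal. -/
theorem isShiftReduced_of_relations (hact : ∀ i, polyAct E M (P i) = 0) : IsShiftReduced s P := by
  have hrow := fun i =>
    rowDeg_eq_of_coeff (degree_diag_of_relations hP i) (coeff_of_relations he hP hact i)
  refine ⟨fun i h => (monic_of_relations hP i).ne_zero (congrFun h i), ?_⟩
  rw [Matrix.isUnit_iff_isUnit_det, Matrix.det_of_isLowerTriangular]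
  · refine IsUnit.mk0 _ (Finset.prod_ne_zero_iff.2 fun i _ => ?_)
    rw [leadingMatrix, Matrix.of_apply, if_pos, monic_of_relations hP i]
    · exact one_ne_zero
    · rw [(hrow i).1, degree_diag_of_relations hP]
  · intro i j hij
    rw [leadingMatrix, Matrix.of_apply, if_neg]
    rw [(hrow i).1]
    exact ((hrow i).2 j hij).ne

/-- Once the diagonal degrees agree, the monic diagonals and the column bounds force `Q i - P i` to
be supported on standard monomials, and it is an interpolant. -/
theorem eq_of_relations (hact : ∀ i, polyAct E M (P i) = 0) {Q : Matrix (Fin m) (Fin m) K[X]}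
    (hQ : IsInterpolationBasis E M Q) (hQp : IsPopov s Q) : Q = P := by
  obtain ⟨-, hpiv, hlt⟩ := hQp
  have hQact : ∀ i, polyAct E M (Q i) = 0 := fun i => by
    have : Q i ∈ interpolants E M := hQ.2 ▸ Submodule.subset_span ⟨i, rfl⟩
    exact this
  have h₁ : ∀ i, e i ≤ (Q i i).natDegree := fun i => by
    have := not_isStandardMonomial_of_polyAct_eq_zero (s := s) (hQact i)
      (d := (Q i i).natDegree) (i := i) (by
        rw [coeff_natDegree, (hpiv i).2]
        exact one_ne_zero) (coeff_of_isPivotIndex (hpiv i).1)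
    rwa [he, not_lt] at this
  have hQ₀ : ∀ j, Q j j ≠ 0 := fun j => (hpiv j).2.ne_zero
  -- Write `P i` as a combination of the rows of `Q`. Some column `j` shows degree at least that of
  -- `Q j j`, which is at least `e j` by `h₁`. In row `i` of `P` such a degree occurs only for `j =
  -- i`, where it equals `e i`.
  have h₂ : ∀ i, (Q i i).natDegree = e i := fun i => by
    have hmem : P i ∈ Submodule.span K[X] (Set.range fun i => Q i) := by
      rw [hQ.2]
      exact hact i
    obtain ⟨a, ha⟩ := (Submodule.mem_span_range_iff_exists_fun _).1 hmem
    have ha₀ : a ≠ 0 := by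
      rintro rfl
      have := congrFun ha i
      simp only [Pi.zero_apply, zero_smul, Finset.sum_const_zero] at this
      exact (monic_of_relations hP i).ne_zero this.symm
    obtain ⟨j, hj, hdeg⟩ := exists_degree_vecMul_eq hQ₀ hlt ha₀
    have haj := congrFun ha j
    simp only [Finset.sum_apply, Pi.smul_apply, smul_eq_mul] at haj
    rw [haj, degree_eq_natDegree hj, degree_eq_natDegree (hQ₀ j)] at hdeg
    have h₃ : (P i j).natDegree = (a j).natDegree + (Q j j).natDegree :=
      natDegree_eq_of_degree_eq_some (by rw [hdeg]; norm_cast)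
    have h₄ := natDegree_le_of_relations hP i j
    have h₅ := h₁ j
    by_cases hij : i = j
    · subst hij
      omega
    · exfalso
      have h₆ := degree_lt_of_relations hP i j hij
      rw [hdeg, degree_diag_of_relations hP] at h₆
      have : (a j).natDegree + (Q j j).natDegree < e j := by exact_mod_cast h₆
      omega
  refine Matrix.ext fun i j => ?_
  have h₃ : Q i - P i = 0 := by
    refine eq_zero_of_coeff_isStandardMonomial (E := E) (M := M) (s := s) ?_ fun k d hd => ?_
    · exact (interpolants E M).sub_mem (hQact i) (hact i)
    · rw [he]
      by_contra hk
      rw [not_lt] at hk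
      refine hd ?_
      rw [Pi.sub_apply, coeff_sub, hP i k d hk, sub_eq_zero]
      by_cases hik : i = k
      · subst hik
        by_cases hde : d = e i
        · have := (hpiv i).2.coeff_natDegree
          rw [h₂] at this
          simp [hde, this]
        · rw [if_neg (by simp [hde])]
          refine coeff_eq_zero_of_natDegree_lt ?_
          rw [h₂]
          omega
      · rw [if_neg (fun h => hik h.1)]
        have := hlt i k hik
        rw [degree_eq_natDegree (hQ₀ k), h₂, degree_lt_iff_coeff_zero] at this
        exact this d hk
  exact congrFun (sub_eq_zero.1 h₃) j

end

variable (E M s) in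
-- The sum counts standard monomials, whose vectors are independent in a space of dimension `σ`.
theorem sum_pivotDegrees_le (he : ∀ i d, d < e i → IsStandardMonomial E M s (i, d)) :
    ∑ i, e i ≤ σ := by
  classical
  let S : Finset (Fin m × ℕ) := Finset.univ.biUnion fun i => (Finset.range (e i)).image (Prod.mk i)
  have hS : S.card = ∑ i, e i := by
    rw [Finset.card_biUnion]
    · refine Finset.sum_congr rfl fun i _ => ?_
      rw [Finset.card_image_of_injective _ (Prod.mk_right_injective i), Finset.card_range]
    · intro i _ j _ hij
      rw [Function.onFun, Finset.disjoint_left]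
      simp only [Finset.mem_image, not_exists, not_and]
      rintro _ ⟨_, _, rfl⟩ _ _ h
      exact hij (Prod.mk.inj h).1.symm
  rw [← hS]
  have := card_le_finrank_of_isStandard (K := K) (f := monomialKey s) (v := krylov E M)
    (monomialKey_injective s) (Set.subset_univ (S : Set (Fin m × ℕ))) fun x hx => ?_
  · simpa using this
  · simp only [S, Finset.mem_biUnion, Finset.mem_image, Finset.mem_range] at hx
    obtain ⟨i, -, d, hd, rfl⟩ := hx
    exact he i d hd

end Popov

/-! ### Listing a finite set in order -/

section Gather

variable {μ o β : Type*} [LinearOrder o] (f : μ → o)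

/-- The number of elements of `S` before `x`. -/
def orderRank (S : Finset μ) (x : μ) : ℕ := (S.filter (f · < f x)).card

open Classical in
/-- The values of `w` at the elements of `S` in order, followed by values `z`. -/
noncomputable def gather (z : β) (n : ℕ) (S : Finset μ) (w : μ → β) (i : Fin n) : β :=
  if h : ∃ x ∈ S, orderRank f S x = i then w h.choose else z

/-- The entry of the vector `a` at the place that `gather` gives to `x`. -/
def scatter (z : β) {n : ℕ} (S : Finset μ) (a : Fin n → β) (x : μ) : β :=
  if h : orderRank f S x < n then a ⟨_, h⟩ else z

variable {f}

theorem orderRank_lt {S : Finset μ} {x y : μ} (hx : x ∈ S) (h : f x < f y) :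
    orderRank f S x < orderRank f S y := by
  refine Finset.card_lt_card ⟨fun z hz => ?_, fun hsub => ?_⟩
  · rw [Finset.mem_filter] at hz ⊢
    exact ⟨hz.1, hz.2.trans h⟩
  · have := hsub (Finset.mem_filter.2 ⟨hx, h⟩)
    exact lt_irrefl _ (Finset.mem_filter.1 this).2

theorem orderRank_lt_iff {S : Finset μ} {x y : μ} (hx : x ∈ S) (hy : y ∈ S) :
    orderRank f S x < orderRank f S y ↔ f x < f y := by
  refine ⟨fun h => ?_, orderRank_lt hx⟩
  by_contra h'
  rcases (not_lt.1 h').lt_or_eq with h' | h'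
  · exact lt_asymm h (orderRank_lt hy h')
  · rw [orderRank, orderRank, h'] at h
    exact lt_irrefl _ h

theorem orderRank_injOn (hf : Function.Injective f) {S : Finset μ} {x y : μ} (hx : x ∈ S)
    (hy : y ∈ S) (h : orderRank f S x = orderRank f S y) : x = y := by
  rcases lt_trichotomy (f x) (f y) with h' | h' | h'
  · exact absurd h (orderRank_lt hx h').ne
  · exact hf h'
  · exact absurd h (orderRank_lt hy h').ne'

theorem orderRank_lt_of_card_le {S : Finset μ} {n : ℕ} (hn : S.card ≤ n) {x : μ} (hx : x ∈ S) :
    orderRank f S x < n := by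
  refine lt_of_lt_of_le (Finset.card_lt_card ⟨Finset.filter_subset _ _, fun hsub => ?_⟩) hn
  exact lt_irrefl _ (Finset.mem_filter.1 (hsub hx)).2

theorem gather_orderRank (hf : Function.Injective f) (z : β) {n : ℕ} {S : Finset μ} (w : μ → β)
    {x : μ} (hx : x ∈ S) (h : orderRank f S x < n) :
    gather f z n S w ⟨orderRank f S x, h⟩ = w x := by
  have hex : ∃ y ∈ S, orderRank f S y = orderRank f S x := ⟨x, hx, rfl⟩
  rw [gather, dif_pos hex]
  exact congrArg w (orderRank_injOn hf hex.choose_spec.1 hx hex.choose_spec.2)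

theorem gather_eq (hf : Function.Injective f) (z : β) {n : ℕ} (S : Finset μ) (w : μ → β)
    (i : Fin n) : (∃ x ∈ S, orderRank f S x = i ∧ gather f z n S w i = w x) ∨
      (∀ x ∈ S, orderRank f S x ≠ i) ∧ gather f z n S w i = z := by
  by_cases h : ∃ x ∈ S, orderRank f S x = i
  · obtain ⟨x, hx, hi⟩ := h
    obtain ⟨i, hi'⟩ := i
    subst hi
    exact Or.inl ⟨x, hx, rfl, gather_orderRank hf z w hx _⟩
  · refine Or.inr ⟨fun x hx hi => h ⟨x, hx, hi⟩, ?_⟩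
    rw [gather, dif_neg h]

theorem scatter_eq (z : β) {n : ℕ} {S : Finset μ} (a : Fin n → β) (hn : S.card ≤ n) {x : μ}
    (hx : x ∈ S) : scatter f z S a x = a ⟨orderRank f S x, orderRank_lt_of_card_le hn hx⟩ :=
  dif_pos _

variable {K V : Type*} [Field K] [AddCommGroup V] [Module K V]

theorem sum_smul_gather (hf : Function.Injective f) {n : ℕ} {S : Finset μ} (hn : S.card ≤ n)
    (c : Fin n → K) (v : μ → V) :
    ∑ i, c i • gather f 0 n S v i = ∑ x ∈ S, scatter f 0 S c x • v x := by
  rw [← Finset.sum_attach S]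
  symm
  refine Finset.sum_of_injOn (fun x => ⟨orderRank f S x, orderRank_lt_of_card_le hn x.2⟩) ?_
    (fun _ _ => Finset.mem_coe.2 (Finset.mem_univ _)) (fun i _ hi => ?_) fun x _ => ?_
  · intro x _ y _ h
    exact Subtype.ext (orderRank_injOn hf x.2 y.2 (congrArg Fin.val h))
  · rcases gather_eq hf (0 : V) S v i with ⟨x, hx, h, -⟩ | ⟨-, h⟩
    · exact absurd ⟨⟨x, hx⟩, by simp, Fin.ext h⟩ hi
    · rw [h, smul_zero]
  · rw [gather_orderRank hf 0 v x.2, scatter_eq 0 c hn x.2]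

theorem range_gather_span (hf : Function.Injective f) {n : ℕ} {S : Finset μ} (hn : S.card ≤ n)
    (v : μ → V) :
    Submodule.span K (v '' S) ≤ Submodule.span K (Set.range (gather f 0 n S v)) := by
  rw [Submodule.span_le]
  rintro _ ⟨x, hx, rfl⟩
  exact Submodule.subset_span ⟨⟨_, orderRank_lt_of_card_le hn hx⟩, gather_orderRank hf 0 v hx _⟩

/-- Listing in increasing order makes "earlier row" mean "smaller element", and padding rows are
zero. Thus a row rank profile detects standardness. -/
theorem span_gather_lt (hf : Function.Injective f) {n : ℕ} {S : Finset μ} (hn : S.card ≤ n)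
    (v : μ → V) {x : μ} (hx : x ∈ S) :
    Submodule.span K (gather f 0 n S v '' {j | j < ⟨_, orderRank_lt_of_card_le (f := f) hn hx⟩}) =
      Submodule.span K (v '' {y | y ∈ (S : Set μ) ∧ f y < f x}) := by
  apply le_antisymm <;> rw [Submodule.span_le]
  · rintro _ ⟨j, hj, rfl⟩
    rcases gather_eq hf (0 : V) S v j with ⟨y, hy, h, h'⟩ | ⟨-, h⟩
    · rw [h']
      refine Submodule.subset_span ⟨y, ⟨hy, ?_⟩, rfl⟩
      rw [← orderRank_lt_iff hy hx, h]
      exact hj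
    · rw [h]
      exact Submodule.zero_mem _
  · rintro _ ⟨y, ⟨hy, hyx⟩, rfl⟩
    exact Submodule.subset_span ⟨⟨_, orderRank_lt_of_card_le hn hy⟩, orderRank_lt hy hyx,
      gather_orderRank hf 0 v hy _⟩

theorem Matrix.IsRankInverse.mem_gather_iff {σ n : ℕ} (hf : Function.Injective f) {S : Finset μ}
    (hn : S.card ≤ n) {v : μ → Fin σ → K} {I : Finset (Fin n)} {G : Matrix (Fin σ) (Fin n) K}
    (h : Matrix.IsRankInverse (gather f 0 n S v : Matrix (Fin n) (Fin σ) K) I G) {x : μ}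
    (hx : x ∈ S) :
    ⟨_, orderRank_lt_of_card_le (f := f) hn hx⟩ ∈ I ↔ IsStandard K f v S x := by
  rw [h.mem_iff, IsStandard, ← span_gather_lt hf hn v hx]
  have h₁ := gather_orderRank hf 0 v hx (orderRank_lt_of_card_le (f := f) hn hx)
  change gather f 0 n S v _ ∉ _ ↔ _
  rw [h₁]

end Gather

/-! ### The algorithm -/

namespace Comp

section Profile

variable {ι μ o : Type} [LinearOrder o] {f : μ → o} {K : Type*} [Field K] {inp : ι → K} {σ : ℕ}

theorem holds_gather (hf : Function.Injective f) {regs : List K} {S : Finset μ}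
    {w : μ → Fin σ → Operand ι} {v : μ → Fin σ → K} (n : ℕ)
    (hw : ∀ x ∈ S, ∀ l, (w x l).Holds inp regs (v x l)) :
    Matrix.Holds inp regs (gather f (fun _ => .zero) n S w) (gather f 0 n S v) := by
  intro i l
  rcases gather_eq hf (fun _ => (Operand.zero : Operand ι)) S w i with ⟨x, hx, hi, h⟩ | ⟨h, h'⟩
  · rcases gather_eq hf (0 : Fin σ → K) S v i with ⟨y, hy, hi', h'⟩ | ⟨h', -⟩
    · obtain rfl := orderRank_injOn hf hx hy (hi.trans hi'.symm)
      rw [h, h']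
      exact hw x hx l
    · exact absurd hi (h' x hx)
  · rcases gather_eq hf (0 : Fin σ → K) S v i with ⟨y, hy, hi', -⟩ | ⟨-, h''⟩
    · exact absurd hi' (h y hy)
    · rw [h', h'']
      exact Operand.holds_zero _

open Classical in
/-- The elements of `S` whose vectors are not combinations of the vectors of their predecessors. -/
noncomputable def profile (mm : MulPrograms) (k : ℕ) (f : μ → o) (S : Finset μ)
    (w : μ → Fin σ → Operand ι) : Comp ι (Finset μ) :=
  rankInverse mm k (gather f (fun _ => .zero) (dbl k) S w) >>= fun y =>
    pure (S.filter fun x => ∃ h : orderRank f S x < dbl k, ⟨_, h⟩ ∈ y.1)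

theorem sat_profile {mm : MulPrograms} (hmm : mm.Correct K) (hf : Function.Injective f) {k : ℕ}
    {S : Finset μ} (hk : S.card ≤ dbl k) {regs : List K} {w : μ → Fin σ → Operand ι}
    {v : μ → Fin σ → K} (hw : ∀ x ∈ S, ∀ l, (w x l).Holds inp regs (v x l)) :
    (profile mm k f S w).Sat inp regs (rankCost mm σ k) fun _ S' =>
      ∀ x, x ∈ S' ↔ x ∈ (S : Set μ) ∧ IsStandard K f v S x := by
  refine Sat.bind (T₂ := 0) (sat_rankInverse hmm k (holds_gather hf _ hw)) ?_
  rintro rs y _ ⟨G, -, hG⟩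
  refine sat_pure fun x => ?_
  rw [Finset.mem_filter, Finset.mem_coe]
  refine and_congr_right fun hx => ?_
  rw [← hG.mem_gather_iff hf hk hx]
  exact ⟨fun h => h.2, fun h => ⟨_, h⟩⟩

end Profile

variable {m σ : ℕ} {K : Type*} [Field K]

/-- The operands that hold the row `i` of `E`. -/
def inputRow (x : Fin m × ℕ) (l : Fin σ) : Operand (TwoMatrices m σ σ σ) := .input (.inl (x.1, l))

/-- The operands that hold the matrix `M`. -/
def inputMatrix (m σ : ℕ) : Matrix (Fin σ) (Fin σ) (Operand (TwoMatrices m σ σ σ)) :=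
  fun i j => .input (.inr (i, j))

/-- The monomials of degree zero at the positions `σ q, …, σ q + σ - 1`. -/
def chunk (m σ q : ℕ) : Finset (Fin m × ℕ) :=
  (Finset.univ.filter fun i : Fin m => i.1 / σ = q).map
    ⟨fun i => (i, 0), fun _ _ h => (Prod.mk.inj h).1⟩

/-- The standard monomials among those of degree zero at the first `σ q` positions. -/
noncomputable def degreeZero (mm : MulPrograms) (k m σ : ℕ) (s : Fin m → ℕ) :
    ℕ → Comp (TwoMatrices m σ σ σ) (Finset (Fin m × ℕ))
  | 0 => pure ∅
  | q + 1 => degreeZero mm k m σ s q >>= fun S =>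
      profile mm k (monomialKey s) (S ∪ chunk m σ q) inputRow

/-- The standard monomials among those of degree less than `2 ^ l`, their vectors, and
`M ^ 2 ^ l`. -/
noncomputable def doubling (mm : MulPrograms) (k m σ q : ℕ) (s : Fin m → ℕ) :
    ℕ → Comp (TwoMatrices m σ σ σ) (Finset (Fin m × ℕ) ×
      (Fin m × ℕ → Fin σ → Operand (TwoMatrices m σ σ σ)) ×
      Matrix (Fin σ) (Fin σ) (Operand (TwoMatrices m σ σ σ)))
  | 0 => degreeZero mm k m σ s q >>= fun S => pure (S, inputRow, inputMatrix m σ)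
  | l + 1 => doubling mm k m σ q s l >>= fun y =>
      mulMatrix mm (dbl k) (one_le_dbl k)
        (gather (monomialKey s) (fun _ => .zero) (dbl k) y.1 y.2.1) y.2.2 >>= fun B =>
      mulMatrix mm (dbl k) (one_le_dbl k) y.2.2 y.2.2 >>= fun D =>
      -- Old candidates keep their vectors; a shifted one reads the row of `B` of the monomial it
      -- came from. Values off the candidate set are irrelevant.
      let w : Fin m × ℕ → Fin σ → Operand (TwoMatrices m σ σ σ) := fun x =>
        if x ∈ y.1 then y.2.1 x
        else scatter (monomialKey s) (fun _ => .zero) y.1 B (x.1, x.2 - 2 ^ l)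
      profile mm k (monomialKey s) (y.1 ∪ y.1.image fun x => (x.1, x.2 + 2 ^ l)) w >>= fun S =>
      pure (S, w, D)

/-- The number of monomials of `S` at the position `i`. -/
def pivotDegree (S : Finset (Fin m × ℕ)) (i : Fin m) : ℕ := (S.filter (·.1 = i)).card

/-- The interpolation basis, from the set `S` of the standard monomials and their vectors `w`. -/
noncomputable def relations (mm : MulPrograms) (k m σ δ : ℕ) (s : Fin m → ℕ)
    (S : Finset (Fin m × ℕ)) (w : Fin m × ℕ → Fin σ → Operand (TwoMatrices m σ σ σ)) :
    Comp (TwoMatrices m σ σ σ) (Fin m → Fin m → List (Operand (TwoMatrices m σ σ σ))) :=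
  rankInverse mm k (gather (monomialKey s) (fun _ => .zero) (dbl k) S w) >>= fun y =>
  mulMatrix mm (dbl k) (one_le_dbl k)
    (gather (monomialKey s) (fun _ => .zero) (dbl k) S w) (inputMatrix m σ) >>= fun B =>
  -- The sign is changed in `G`, before the product, so that the cost of negation does not depend on
  -- `m`.
  entrywise .sub (fun _ _ => .zero) y.2 >>= fun G =>
  mulMatrix mm (dbl k) (one_le_dbl k) (fun i =>
    -- The vector of `X ^ (e i) e_i` is an input row if `e i = 0`; otherwise it is `M` applied to
    -- the vector of the last standard monomial at `i`.
    if pivotDegree S i = 0 then inputRow (i, 0)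
    else scatter (monomialKey s) (fun _ => .zero) S B (i, pivotDegree S i - 1)) G >>= fun D =>
  pure fun i j => (List.range (δ + 1)).map fun d =>
    if (j, d) ∈ S then scatter (monomialKey s) .zero S (D i) (j, d)
    else if i = j ∧ d = pivotDegree S j then .one else .zero

theorem holds_inputRow (E : Matrix (Fin m) (Fin σ) K) (M : Matrix (Fin σ) (Fin σ) K)
    (regs : List K) (i : Fin m) (l : Fin σ) :
    (inputRow (i, 0) l).Holds (matrixInputs E M) regs (krylov E M (i, 0) l) := by
  have : krylov E M (i, 0) l = E i l := by simp [krylov]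
  rw [this]
  exact Operand.holds_input _ _

theorem holds_inputMatrix (E : Matrix (Fin m) (Fin σ) K) (M : Matrix (Fin σ) (Fin σ) K)
    (regs : List K) : (inputMatrix m σ).Holds (matrixInputs E M) regs M :=
  fun _ _ => Operand.holds_input _ _

theorem card_chunk_le (hσ : 1 ≤ σ) (q : ℕ) : (chunk m σ q).card ≤ σ := by
  rw [chunk, Finset.card_map]
  conv_rhs => rw [← Finset.card_range σ]
  refine Finset.card_le_card_of_injOn (fun i => i.1 % σ)
    (fun i _ => by simpa using Nat.mod_lt _ hσ) fun i hi j hj h => ?_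
  simp only [Finset.coe_filter, Finset.mem_univ, true_and, Set.mem_ofPred_eq] at hi hj h
  refine Fin.ext ?_
  rw [← Nat.div_add_mod i.1 σ, ← Nat.div_add_mod j.1 σ, hi, hj, h]

theorem card_le_of_isStandard {E : Matrix (Fin m) (Fin σ) K} {M : Matrix (Fin σ) (Fin σ) K}
    {s : Fin m → ℕ} {S : Finset (Fin m × ℕ)} {T : Set (Fin m × ℕ)}
    (hS : ∀ x, x ∈ S ↔ x ∈ T ∧ IsStandard K (monomialKey s) (krylov E M) T x) : S.card ≤ σ := by
  have := card_le_finrank_of_isStandard (K := K) (monomialKey_injective s) (S := S) (T := T)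
    (fun x hx => ((hS x).1 hx).1) fun x hx => ((hS x).1 hx).2
  simpa using this

variable {mm : MulPrograms} {k : ℕ} {E : Matrix (Fin m) (Fin σ) K} {M : Matrix (Fin σ) (Fin σ) K}
  {s : Fin m → ℕ}

theorem sat_degreeZero (hmm : mm.Correct K) (hσ : 1 ≤ σ) (hk : 2 * σ ≤ dbl k) (regs : List K) :
    ∀ q, (degreeZero mm k m σ s q).Sat (matrixInputs E M) regs (q * rankCost mm σ k) fun _ S =>
      ∀ x, x ∈ S ↔ x ∈ {y : Fin m × ℕ | y.2 = 0 ∧ y.1.1 / σ < q} ∧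
        IsStandard K (monomialKey s) (krylov E M) {y | y.2 = 0 ∧ y.1.1 / σ < q} x
  | 0 => sat_pure (by simp)
  | q + 1 => by
    rw [Nat.succ_mul]
    refine (sat_degreeZero hmm hσ hk regs q).bind fun rs S _ hS => ?_
    have hmem : ∀ x : Fin m × ℕ, x ∈ chunk m σ q ↔ x.2 = 0 ∧ x.1.1 / σ = q := by
      rintro ⟨i, d⟩
      rw [chunk, Finset.mem_map]
      constructor
      · rintro ⟨i', h, heq⟩
        obtain ⟨rfl, rfl⟩ := Prod.mk.inj heq
        exact ⟨rfl, (Finset.mem_filter.1 h).2⟩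
      · rintro ⟨rfl, h⟩
        exact ⟨i, Finset.mem_filter.2 ⟨Finset.mem_univ i, h⟩, rfl⟩
    -- At most `σ` survivors and at most `σ` new monomials: this is why the matrices get `dbl k ≥ 2
    -- * σ` rows.
    have hcard : (S ∪ chunk m σ q).card ≤ dbl k := by
      have h₁ := Finset.card_union_le S (chunk m σ q)
      have h₂ := card_le_of_isStandard hS
      have h₃ := card_chunk_le (m := m) hσ q
      omega
    have hsub : ∀ x ∈ S ∪ chunk m σ q, x.2 = 0 ∧ x.1.1 / σ < q + 1 := by
      intro x hx
      rcases Finset.mem_union.1 hx with hx | hx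
      · have := ((hS x).1 hx).1
        exact ⟨this.1, this.2.trans (Nat.lt_succ_self q)⟩
      · have := (hmem x).1 hx
        exact ⟨this.1, this.2 ▸ Nat.lt_succ_self q⟩
    refine (sat_profile hmm (monomialKey_injective s) hcard (v := krylov E M) ?_).mono le_rfl ?_
    · rintro ⟨i, d⟩ hx l
      obtain rfl : d = 0 := (hsub _ hx).1
      exact holds_inputRow E M _ i l
    · intro _ S' _ hS' x
      rw [hS']
      -- A monomial discarded in an earlier chunk is a combination of smaller survivors, so it never
      -- has to be reconsidered.
      refine (isStandard_iff_of_subset hsub fun x hx hx' => ?_) x |>.symm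
      rw [Finset.mem_coe, Finset.mem_union, hmem, not_or] at hx'
      have h₁ : x ∈ {y : Fin m × ℕ | y.2 = 0 ∧ y.1.1 / σ < q} :=
        ⟨hx.1, lt_of_le_of_ne (Nat.lt_succ_iff.1 hx.2) fun h => hx'.2 ⟨hx.1, h⟩⟩
      have h₂ := mem_span_isStandard_lt fun h => hx'.1 ((hS x).2 ⟨h₁, h⟩)
      exact mem_span_image_mono h₂ fun y hy =>
        ⟨Finset.mem_coe.2 (Finset.mem_union_left _ ((hS y).2 hy.1)), hy.2⟩

/-- A monomial of degree below `N` outside `S` is a combination of smaller elements of `S`;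
multiplying by `M ^ N` gives the same for its shift by `N`. All other monomials of degree below `2
N` can therefore be left out. -/
theorem isStandard_double_iff {N : ℕ} {S : Finset (Fin m × ℕ)}
    (hS : ∀ x, x ∈ S ↔ x ∈ {y : Fin m × ℕ | y.2 < N} ∧
      IsStandard K (monomialKey s) (krylov E M) {y | y.2 < N} x) (x : Fin m × ℕ) :
    x ∈ {y : Fin m × ℕ | y.2 < N + N} ∧
        IsStandard K (monomialKey s) (krylov E M) {y | y.2 < N + N} x ↔
      x ∈ ((S ∪ S.image fun x => (x.1, x.2 + N) : Finset (Fin m × ℕ)) : Set (Fin m × ℕ)) ∧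
        IsStandard K (monomialKey s) (krylov E M)
          ((S ∪ S.image fun x => (x.1, x.2 + N) : Finset (Fin m × ℕ)) : Set (Fin m × ℕ)) x := by
  have hlt : ∀ x ∈ S, x.2 < N := fun x hx => ((hS x).1 hx).1
  refine isStandard_iff_of_subset ?_ ?_ x
  · intro x hx
    rw [Finset.mem_coe, Finset.mem_union, Finset.mem_image] at hx
    rcases hx with hx | ⟨y, hy, rfl⟩
    · exact (hlt x hx).trans_le (Nat.le_add_right N N)
    · exact Nat.add_lt_add_right (hlt y hy) N
  · intro x hx hx'
    rw [Finset.mem_coe, Finset.mem_union, not_or, Finset.mem_image] at hx'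
    by_cases hxN : x.2 < N
    · have h₂ := mem_span_isStandard_lt fun h => hx'.1 ((hS x).2 ⟨hxN, h⟩)
      exact mem_span_image_mono h₂ fun y hy =>
        ⟨Finset.mem_coe.2 (Finset.mem_union_left _ ((hS y).2 hy.1)), hy.2⟩
    · obtain ⟨i, d⟩ := x
      obtain ⟨d, rfl⟩ := Nat.exists_eq_add_of_le' (not_lt.1 hxN)
      have hd : d < N := Nat.lt_of_add_lt_add_right hx
      have h₂ := mem_span_isStandard_lt (x := (i, d)) fun h =>
        hx'.2 ⟨(i, d), (hS _).2 ⟨hd, h⟩, rfl⟩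
      have h₃ := Submodule.mem_map_of_mem (f := Matrix.vecMulLinear (M ^ N)) h₂
      rw [Submodule.map_span, Matrix.vecMulLinear_apply, ← krylov_add] at h₃
      refine Submodule.span_mono ?_ h₃
      rintro _ ⟨_, ⟨⟨j, e⟩, he, rfl⟩, rfl⟩
      refine ⟨(j, e + N), ⟨?_, (monomialKey_add_lt_iff N).2 he.2⟩, ?_⟩
      · rw [Finset.mem_coe, Finset.mem_union, Finset.mem_image]
        exact Or.inr ⟨(j, e), (hS _).2 he.1, rfl⟩
      · rw [krylov_add]
        rfl

theorem holds_scatter {S : Finset (Fin m × ℕ)} {n : ℕ} (hn : S.card ≤ n) {regs : List K}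
    {B : Matrix (Fin n) (Fin σ) (Operand (TwoMatrices m σ σ σ))} {N : Matrix (Fin σ) (Fin σ) K}
    {v : Fin m × ℕ → Fin σ → K} (hB : B.Holds (matrixInputs E M) regs
      (Matrix.of (gather (monomialKey s) 0 n S v) * N))
    {x : Fin m × ℕ} (hx : x ∈ S) (l : Fin σ) :
    (scatter (monomialKey s) (fun _ => .zero) S B x l).Holds (matrixInputs E M) regs
      (Matrix.vecMul (v x) N l) := by
  rw [show scatter (monomialKey s) (fun _ => .zero) S B x l = B ⟨_, _⟩ l from
    congrFun (scatter_eq _ _ hn hx) l]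
  have h₁ := hB ⟨_, orderRank_lt_of_card_le (f := monomialKey s) hn hx⟩ l
  have h₂ := gather_orderRank (monomialKey_injective s) 0 v hx
    (orderRank_lt_of_card_le (f := monomialKey s) hn hx)
  rw [← h₂]
  exact h₁

/-- The cost of a step of `doubling`. -/
def doublingCost (mm : MulPrograms) (k σ : ℕ) : ℕ :=
  mulCost mm (dbl k) (dbl k) σ σ + (mulCost mm (dbl k) σ σ σ + rankCost mm σ k)

theorem sat_doubling (hmm : mm.Correct K) (hσ : 1 ≤ σ) (hk : 2 * σ ≤ dbl k) {q : ℕ}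
    (hq : m ≤ q * σ) (regs : List K) : ∀ l, (doubling mm k m σ q s l).Sat (matrixInputs E M) regs
      (q * rankCost mm σ k + l * doublingCost mm k σ) fun rs y =>
        (∀ x, x ∈ y.1 ↔ x ∈ {y : Fin m × ℕ | y.2 < 2 ^ l} ∧
          IsStandard K (monomialKey s) (krylov E M) {y | y.2 < 2 ^ l} x) ∧
        (∀ x ∈ y.1, ∀ j, (y.2.1 x j).Holds (matrixInputs E M) rs (krylov E M x j)) ∧
        y.2.2.Holds (matrixInputs E M) rs (M ^ 2 ^ l)
  | 0 => by
    refine (sat_degreeZero (s := s) hmm hσ hk regs q).bind fun rs S _ hS => sat_pure ?_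
    -- Since `m ≤ q * σ`, the first `q` chunks contain all positions.
    have hset : {y : Fin m × ℕ | y.2 = 0 ∧ y.1.1 / σ < q} = {y | y.2 < 2 ^ 0} := by
      ext y
      simp only [Set.mem_ofPred_eq, pow_zero, Nat.lt_one_iff, and_iff_left_iff_imp]
      intro _
      rw [Nat.div_lt_iff_lt_mul hσ]
      exact y.1.2.trans_le hq
    rw [hset] at hS
    refine ⟨hS, ?_, ?_⟩
    · rintro ⟨i, d⟩ hx j
      obtain rfl : d = 0 := by simpa using ((hS _).1 hx).1
      exact holds_inputRow E M _ i j
    · rw [pow_zero, pow_one]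
      exact holds_inputMatrix E M rs
  | l + 1 => by
    rw [Nat.succ_mul, ← add_assoc]
    refine (sat_doubling hmm hσ hk hq regs l).bind ?_
    rintro rs ⟨S, w, D⟩ _ ⟨hS, hw, hD⟩
    have hf := monomialKey_injective s
    have hcard : S.card ≤ dbl k := (card_le_of_isStandard hS).trans (by omega)
    refine (sat_mulMatrix hmm _ (holds_gather hf _ hw) hD).bind fun r₁ B h₁ hB => ?_
    refine Sat.bind (T₂ := rankCost mm σ k)
      (sat_mulMatrix hmm _ (hD.mono h₁) (hD.mono h₁)) fun r₂ D' h₂ hD' => ?_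
    have hw' : ∀ x ∈ S ∪ S.image fun x => (x.1, x.2 + 2 ^ l), ∀ j,
        ((if x ∈ S then w x else scatter (monomialKey s) (fun _ => .zero) S B (x.1, x.2 - 2 ^ l)) j
          : Operand (TwoMatrices m σ σ σ)).Holds (matrixInputs E M) r₂ (krylov E M x j) := by
      intro x hx j
      by_cases hxS : x ∈ S
      · rw [if_pos hxS]
        exact (hw x hxS j).mono (h₁.trans h₂)
      · rw [if_neg hxS]
        obtain ⟨⟨i, d⟩, hy, rfl⟩ := Finset.mem_image.1 ((Finset.mem_union.1 hx).resolve_left hxS)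
        rw [krylov_add, Nat.add_sub_cancel]
        exact holds_scatter hcard (hB.mono h₂) hy j
    refine Sat.bind (T₁ := rankCost mm σ k) (T₂ := 0) (sat_profile hmm hf ?_ hw')
      fun r₃ S' h₃ hS' => sat_pure ⟨fun x => ?_, fun x hx j => ?_, ?_⟩
    · have := Finset.card_union_le S (S.image fun x => (x.1, x.2 + 2 ^ l))
      have h₄ := Finset.card_image_le (s := S) (f := fun x => (x.1, x.2 + 2 ^ l))
      have h₅ : S.card ≤ σ := card_le_of_isStandard hS
      exact this.trans (by omega)
    · rw [hS', ← isStandard_double_iff hS, pow_succ, mul_two]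
    · exact (hw' x ((hS' x).1 hx).1 j).mono h₃
    · rw [pow_succ, mul_two, pow_add]
      exact hD'.mono h₃

end Comp

theorem coeff_polyOfCoeffs {K : Type*} [Field K] : ∀ (l : List K) (d : ℕ),
    (polyOfCoeffs l).coeff d = l.getD d 0
  | [], d => by simp [polyOfCoeffs]
  | a :: l, 0 => by simp [polyOfCoeffs]
  | a :: l, d + 1 => by
    rw [polyOfCoeffs, coeff_add, coeff_C_succ, coeff_X_mul, zero_add, coeff_polyOfCoeffs l d,
      List.getD_cons_succ]

/-! ### Reading off the coefficients, and correctness of the algorithm -/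

namespace Comp

variable {m σ : ℕ} {K : Type*} [Field K] {mm : MulPrograms} {k : ℕ}
  {E : Matrix (Fin m) (Fin σ) K} {M : Matrix (Fin σ) (Fin σ) K} {s : Fin m → ℕ}

theorem pivotDegree_eq {S : Finset (Fin m × ℕ)} {e : Fin m → ℕ} (h : ∀ i d, (i, d) ∈ S ↔ d < e i)
    (i : Fin m) : pivotDegree S i = e i := by
  have : S.filter (·.1 = i) = (Finset.range (e i)).image (Prod.mk i) := by
    ext ⟨j, d⟩
    simp only [Finset.mem_filter, h, Finset.mem_image, Finset.mem_range, Prod.mk.injEq]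
    constructor
    · rintro ⟨h₁, rfl⟩
      exact ⟨d, h₁, rfl, rfl⟩
    · rintro ⟨_, h₁, rfl, rfl⟩
      exact ⟨h₁, rfl⟩
  rw [pivotDegree, this, Finset.card_image_of_injective _ (Prod.mk_right_injective i),
    Finset.card_range]

/-- The rows of a matrix are interpolants if its coefficients at the standard monomials are
obtained from a matrix `G` that exhibits their independence. -/
theorem polyAct_eq_zero_of_coeff {S : Finset (Fin m × ℕ)} {e : Fin m → ℕ}
    (hS : ∀ x, x ∈ S ↔ IsStandardMonomial E M s x) (hSe : ∀ i d, (i, d) ∈ S ↔ d < e i) {n : ℕ}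
    (hn : S.card ≤ n) {I : Finset (Fin n)} {G : Matrix (Fin σ) (Fin n) K}
    (hG : Matrix.IsRankInverse (Matrix.of (gather (monomialKey s) 0 n S (krylov E M))) I G)
    {i : Fin m} {p : Fin m → K[X]} (hp : ∀ j d, (p j).coeff d =
      if (j, d) ∈ S then
        scatter (monomialKey s) 0 S (Matrix.vecMul (krylov E M (i, e i)) (0 - G)) (j, d)
      else if i = j ∧ d = e j then 1 else 0) : polyAct E M p = 0 := by
  classical
  obtain ⟨N, hN⟩ := exists_natDegree_lt p
  have hf := monomialKey_injective s
  have hie : (i, e i) ∉ S := by simp [hSe]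
  -- The range of degrees must cover the support of `p` as well as all standard monomials and the
  -- pivot.
  have hsub : insert (i, e i) S ⊆ Finset.univ ×ˢ Finset.range (max N (Finset.univ.sup e + 1)) := by
    have hsup : ∀ j, e j ≤ Finset.univ.sup e := fun j => Finset.le_sup (Finset.mem_univ j)
    rintro ⟨j, d⟩ hx
    simp only [Finset.mem_product, Finset.mem_univ, Finset.mem_range, true_and, lt_max_iff]
    right
    rcases Finset.mem_insert.1 hx with hx | hx
    · obtain ⟨rfl, rfl⟩ := Prod.mk.inj hx
      exact Nat.lt_succ_of_le (hsup _)
    · exact ((hSe j d).1 hx).trans_le ((hsup j).trans (Nat.le_succ _))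
  rw [polyAct_eq_sum fun j => (hN j).trans_le (le_max_left _ _), ← Finset.sum_subset hsub]
  · have hlast : (p i).coeff (e i) = 1 := by rw [hp, if_neg hie, if_pos ⟨rfl, rfl⟩]
    have hspan : krylov E M (i, e i) ∈ Submodule.span K (krylov E M '' S) := by
      have h₁ : ¬ IsStandardMonomial E M s (i, e i) := fun h => hie ((hS _).2 h)
      exact mem_span_image_mono (mem_span_isStandard_lt h₁) fun y hy =>
        Finset.mem_coe.2 ((hS y).2 hy.1.2)
    have h₂ := hG.vecMul_vecMul (range_gather_span hf hn _ hspan)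
    have h₃ := sum_smul_gather hf hn (Matrix.vecMul (krylov E M (i, e i)) (0 - G)) (krylov E M)
    have h₄ : ∑ x ∈ S, (p x.1).coeff x.2 • krylov E M x = ∑ x ∈ S, scatter (monomialKey s) 0 S
        (Matrix.vecMul (krylov E M (i, e i)) (0 - G)) x • krylov E M x :=
      Finset.sum_congr rfl fun x hx => by rw [hp, if_pos hx]
    rw [Finset.sum_insert hie, h₄, ← h₃, hlast, one_smul]
    -- The pivot vector lies in the row span, so `G` yields coordinates of it; their negatives
    -- cancel the pivot term.
    have h₅ : ∑ j, Matrix.vecMul (krylov E M (i, e i)) (0 - G) j •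
        gather (monomialKey s) 0 n S (krylov E M) j = - krylov E M (i, e i) := by
      have h₆ : ∑ j, Matrix.vecMul (krylov E M (i, e i)) G j •
          gather (monomialKey s) 0 n S (krylov E M) j = krylov E M (i, e i) := by
        conv_rhs => rw [← h₂, Matrix.vecMul_eq_sum]
        rfl
      rw [zero_sub, Matrix.vecMul_neg]
      simp only [Pi.neg_apply, neg_smul, Finset.sum_neg_distrib, h₆]
    rw [h₅, add_neg_cancel]
  · intro x _ hx
    rw [Finset.mem_insert, not_or] at hx
    rw [hp, if_neg hx.2, if_neg, zero_smul]
    rintro ⟨h₁, h₂⟩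
    exact hx.1 (Prod.ext h₁.symm (by rw [h₂, h₁]))

/-- The cost of `relations`. -/
def relationsCost (mm : MulPrograms) (k m σ : ℕ) : ℕ :=
  rankCost mm σ k + (mulCost mm (dbl k) (dbl k) σ σ + (σ * dbl k + mulCost mm (dbl k) m σ (dbl k)))

theorem sat_relations (hmm : mm.Correct K) {S : Finset (Fin m × ℕ)} {e : Fin m → ℕ} {δ : ℕ}
    (hS : ∀ x, x ∈ S ↔ IsStandardMonomial E M s x) (hSe : ∀ i d, (i, d) ∈ S ↔ d < e i)
    (heδ : ∀ i, e i ≤ δ) (hn : S.card ≤ dbl k) {regs : List K}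
    {w : Fin m × ℕ → Fin σ → Operand (TwoMatrices m σ σ σ)}
    (hw : ∀ x ∈ S, ∀ l, (w x l).Holds (matrixInputs E M) regs (krylov E M x l)) :
    (relations mm k m σ δ s S w).Sat (matrixInputs E M) regs (relationsCost mm k m σ)
      fun rs out => ∀ P : Matrix (Fin m) (Fin m) K[X],
        (∀ i j, P i j = polyOfCoeffs ((out i j).map (Operand.eval (matrixInputs E M) rs))) →
        (∀ i j d, e j ≤ d → (P i j).coeff d = if i = j ∧ d = e j then 1 else 0) ∧
        ∀ i, polyAct E M (P i) = 0 := by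
  have hf := monomialKey_injective s
  have hgather := holds_gather hf (dbl k) hw
  refine (sat_rankInverse hmm k hgather).bind ?_
  rintro r₁ ⟨I, G⟩ h₁ ⟨G', hG, hGI⟩
  refine (sat_mulMatrix hmm _ (hgather.mono h₁) (holds_inputMatrix E M _)).bind
    fun r₂ B h₂ hB => ?_
  refine (sat_entrywise_sub (A' := 0) (fun _ _ => Operand.holds_zero _) (hG.mono h₂)).bind
    fun r₃ G₀ h₃ hG₀ => ?_
  refine Sat.bind (T₂ := 0) (sat_mulMatrix hmm _
    (A' := Matrix.of fun i => krylov E M (i, e i)) (fun i l => ?_) hG₀) fun r₄ D h₄ hD => ?_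
  · rw [pivotDegree_eq hSe, Matrix.of_apply]
    by_cases h₀ : e i = 0
    · rw [if_pos h₀, h₀]
      exact holds_inputRow E M _ i l
    · rw [if_neg h₀]
      have hmem : (i, e i - 1) ∈ S := (hSe _ _).2 (by omega)
      have h₅ := holds_scatter hn (hB.mono h₃) hmem l
      have h₆ := krylov_add (E := E) (M := M) i (e i - 1) 1
      rw [Nat.sub_add_cancel (Nat.one_le_iff_ne_zero.2 h₀), pow_one] at h₆
      rw [h₆]
      exact h₅
  · refine sat_pure fun P hP => ?_
    have hcoeff : ∀ i j d, (P i j).coeff d =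
        if (j, d) ∈ S then
          scatter (monomialKey s) 0 S (Matrix.vecMul (krylov E M (i, e i)) (0 - G')) (j, d)
        else if i = j ∧ d = e j then 1 else 0 := by
      intro i j d
      rw [hP, coeff_polyOfCoeffs]
      -- Beyond the `δ + 1` listed coefficients, the default `0` of the list is the correct value.
      have hle : ∀ d, (j, d) ∈ S ∨ i = j ∧ d = e j → d < δ + 1 := by
        rintro d (h | h)
        · exact ((hSe j d).1 h).trans_le ((heδ j).trans (Nat.le_succ _))
        · exact h.2 ▸ Nat.lt_succ_of_le (heδ j)
      by_cases hd : d < δ + 1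
      · rw [List.map_map, List.getD_eq_getElem?_getD, List.getElem?_map,
          List.getElem?_range hd, Option.map_some, Option.getD_some, Function.comp_apply,
          pivotDegree_eq hSe]
        split_ifs with h₅ h₆
        · rw [scatter_eq _ _ hn h₅, scatter_eq _ _ hn h₅]
          exact (hD i _).eval
        · rfl
        · rfl
      · rw [List.getD_eq_default _ _ (by simpa using hd), if_neg fun h => hd (hle d (Or.inl h)),
          if_neg fun h => hd (hle d (Or.inr h))]
    refine ⟨fun i j d hd => ?_, fun i => polyAct_eq_zero_of_coeff hS hSe hn hGI (hcoeff i)⟩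
    rw [hcoeff, if_neg (by rw [hSe]; exact not_lt.2 hd)]

/-- The algorithm that computes the interpolation basis in Popov form. -/
noncomputable def popovBasis (mm : MulPrograms) (k m σ q l δ : ℕ) (s : Fin m → ℕ) :
    Comp (TwoMatrices m σ σ σ) (Fin m → Fin m → List (Operand (TwoMatrices m σ σ σ))) :=
  doubling mm k m σ q s l >>= fun y => relations mm k m σ δ s y.1 y.2.1

theorem sat_popovBasis (hmm : mm.Correct K) (hσ : 1 ≤ σ) (hk : 2 * σ ≤ dbl k) {q l δ : ℕ}
    (hq : m ≤ q * σ) (hδ : (minpoly K M).natDegree ≤ δ) (hl : δ ≤ 2 ^ l) {e : Fin m → ℕ}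
    (he : ∀ i d, IsStandardMonomial E M s (i, d) ↔ d < e i)
    (heM : ∀ i, e i ≤ (minpoly K M).natDegree) :
    (popovBasis mm k m σ q l δ s).Sat (matrixInputs E M) []
      (q * rankCost mm σ k + l * doublingCost mm k σ + relationsCost mm k m σ)
      fun rs out => ∀ P : Matrix (Fin m) (Fin m) K[X],
        (∀ i j, P i j = polyOfCoeffs ((out i j).map (Operand.eval (matrixInputs E M) rs))) →
        (∀ i j d, e j ≤ d → (P i j).coeff d = if i = j ∧ d = e j then 1 else 0) ∧
        ∀ i, polyAct E M (P i) = 0 := by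
  refine (sat_doubling hmm hσ hk hq [] l).bind ?_
  rintro rs ⟨S, w, D⟩ _ ⟨hS, hw, -⟩
  -- As `2 ^ l` is at least the degree of the minimal polynomial, degrees beyond it contribute no
  -- standard monomial and do not affect the smaller ones.
  have hS' : ∀ x, x ∈ S ↔ IsStandardMonomial E M s x := fun x => by
    rw [isStandardMonomial_iff (hδ.trans hl)]
    exact hS x
  refine sat_relations hmm hS' (fun i d => (hS' _).trans (he i d)) (fun i => (heM i).trans hδ) ?_ hw
  have : S.card ≤ σ := card_le_of_isStandard hS
  omega

end Comp

/-! ### The number of operations -/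

namespace Comp

section Cost

variable {mm : MulPrograms} {ω C₀ r : ℝ}

/-- Here `2 ^ ω = 4 * r`, so the excess of `ω` over `2` is isolated in the powers of `r`. -/
theorem cost_dbl_le (hω : 2 ≤ ω)
    (hmm : ∀ n, 1 ≤ n → ((mm n).cost : ℝ) ≤ C₀ * (n : ℝ) ^ ω) (hr : r = 2 ^ (ω - 2)) (j : ℕ) :
    (((mm (dbl j)).cost + dbl j * dbl j : ℕ) : ℝ) ≤ (C₀ + 1) * (4 ^ j * r ^ j) := by
  have h₁ : ((dbl j : ℕ) : ℝ) ^ ω = 4 ^ j * r ^ j := by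
    have h₂ : (2 : ℝ) ^ ω = 4 * r := by
      rw [hr, Real.rpow_sub two_pos, Real.rpow_two]
      ring
    rw [dbl_eq, Nat.cast_pow, Nat.cast_ofNat, ← Real.rpow_natCast, ← Real.rpow_mul two_pos.le,
      mul_comm, Real.rpow_mul two_pos.le, Real.rpow_natCast, h₂, mul_pow]
  have h₃ := hmm (dbl j) (one_le_dbl j)
  have hr₁ : 1 ≤ r := hr ▸ Real.one_le_rpow one_le_two (by linarith)
  have h₄ : ((dbl j * dbl j : ℕ) : ℝ) ≤ 4 ^ j * r ^ j := by
    have h₅ : ((dbl j * dbl j : ℕ) : ℝ) = 4 ^ j := by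
      rw [dbl_eq, ← mul_pow]
      norm_num
    rw [h₅]
    exact le_mul_of_one_le_right (by positivity) (one_le_pow₀ hr₁)
  rw [h₁] at h₃
  push_cast at h₄ ⊢
  linarith

/-- At size `2 ^ j`, a product with two sides `2 ^ j` and one side `σ` costs about `(σ + 2 ^ j) * 2
^ j * r ^ j`. The two recursive calls double the factor `2 ^ j`, so the levels add up to `∑ r ^ i`.
Fixing `dbl k` in place of `dbl j` keeps one factor `σ + dbl k` for all levels. -/
theorem rankCost_le (hω : 2 ≤ ω) (hC₀ : 0 ≤ C₀)
    (hmm : ∀ n, 1 ≤ n → ((mm n).cost : ℝ) ≤ C₀ * (n : ℝ) ^ ω) (hr : r = 2 ^ (ω - 2)) {k σ : ℕ} :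
    ∀ j ≤ k, (rankCost mm σ j : ℝ) ≤ (20 * (C₀ + 1) + 3) * (σ + dbl k) *
      (2 ^ j * ∑ i ∈ Finset.range (j + 1), r ^ i)
  | 0, _ => by
    have h₁ : (1 : ℝ) ≤ dbl k := by exact_mod_cast one_le_dbl k
    have h₂ : (0 : ℝ) ≤ σ := Nat.cast_nonneg σ
    simp only [rankCost, zero_add, pow_zero, Finset.range_one, Finset.sum_singleton, mul_one]
    push_cast
    nlinarith [mul_nonneg hC₀ (add_nonneg h₂ (zero_le_one.trans h₁))]
  | j + 1, hj => by
    have ih := rankCost_le (σ := σ) hω hC₀ hmm hr j (Nat.le_of_succ_le hj)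
    have hb := cost_dbl_le hω hmm hr j
    have hr₁ : 1 ≤ r := hr ▸ Real.one_le_rpow one_le_two (by linarith)
    have hdj : (dbl j : ℝ) = 2 ^ j := by rw [dbl_eq]; norm_num
    have hjk : (dbl j : ℝ) ≤ dbl k := by
      rw [dbl_eq, dbl_eq]
      exact_mod_cast Nat.pow_le_pow_right two_pos (Nat.le_of_succ_le hj)
    have hblocks : ((σ / dbl j + 1 : ℕ) : ℝ) * 2 ^ j ≤ σ + dbl k := by
      have : σ / dbl j * dbl j ≤ σ := Nat.div_mul_le_self _ _
      have h : ((σ / dbl j : ℕ) : ℝ) * dbl j ≤ σ := by exact_mod_cast this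
      rw [← hdj]
      push_cast at h ⊢
      linarith
    set W : ℝ := σ + dbl k with hW
    have hmul : (4 * ((σ / dbl j + 1) * ((mm (dbl j)).cost + dbl j * dbl j)) : ℕ) ≤
        4 * (C₀ + 1) * W * (2 ^ j * r ^ j) := by
      have h₁ : ((σ / dbl j + 1 : ℕ) : ℝ) * ((C₀ + 1) * (4 ^ j * r ^ j)) =
          (((σ / dbl j + 1 : ℕ) : ℝ) * 2 ^ j) * ((C₀ + 1) * (2 ^ j * r ^ j)) := by
        rw [show (4 : ℝ) = 2 * 2 by norm_num, mul_pow]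
        ring
      have h₂ := mul_le_mul_of_nonneg_left hb (Nat.cast_nonneg (α := ℝ) (σ / dbl j + 1))
      have h₃ := mul_le_mul_of_nonneg_right hblocks
        (show 0 ≤ (C₀ + 1) * (2 ^ j * r ^ j) by positivity)
      rw [h₁] at h₂
      have h₄ := h₂.trans h₃
      rw [Nat.cast_mul, Nat.cast_mul, Nat.cast_ofNat]
      linarith
    have hsmall : ((dbl j * σ : ℕ) : ℝ) ≤ W * (2 ^ j * r ^ j) := by
      have h₁ : (σ : ℝ) ≤ W := by rw [hW]; exact le_add_of_nonneg_right (Nat.cast_nonneg _)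
      have h₂ : (2 : ℝ) ^ j ≤ 2 ^ j * r ^ j :=
        le_mul_of_one_le_right (by positivity) (one_le_pow₀ hr₁)
      rw [Nat.cast_mul, hdj, mul_comm]
      exact mul_le_mul h₁ h₂ (by positivity) ((Nat.cast_nonneg σ).trans h₁)
    -- Five products and three subtractions join the halves. A side `dbl j` counts as two blocks,
    -- whence the factor `4`.
    have hrec : rankCost mm σ (j + 1) = 2 * rankCost mm σ j +
        5 * (4 * ((σ / dbl j + 1) * ((mm (dbl j)).cost + dbl j * dbl j))) + 3 * (dbl j * σ) := by
      simp only [rankCost, mulCost, Nat.div_self (one_le_dbl j)]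
      ring
    rw [hrec, Finset.sum_range_succ _ (j + 1)]
    have hpow : r ^ j ≤ r ^ (j + 1) := pow_le_pow_right₀ hr₁ (Nat.le_succ j)
    have h₅ : (20 * (C₀ + 1) + 3) * W * (2 ^ j * r ^ j) ≤
        (20 * (C₀ + 1) + 3) * W * (2 ^ (j + 1) * r ^ (j + 1)) := by
      refine mul_le_mul_of_nonneg_left ?_ (by positivity)
      refine mul_le_mul ?_ hpow (by positivity) (by positivity)
      exact pow_le_pow_right₀ one_le_two (Nat.le_succ j)
    rw [Nat.cast_add, Nat.cast_add, Nat.cast_mul 2, Nat.cast_mul 5, Nat.cast_mul 3]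
    have h₆ : (20 * (C₀ + 1) + 3) * W * (2 ^ (j + 1) * (∑ i ∈ Finset.range (j + 1), r ^ i +
        r ^ (j + 1))) = 2 * ((20 * (C₀ + 1) + 3) * W * (2 ^ j * ∑ i ∈ Finset.range (j + 1), r ^ i))
        + (20 * (C₀ + 1) + 3) * W * (2 ^ (j + 1) * r ^ (j + 1)) := by
      rw [pow_succ (2 : ℝ) j]
      ring
    rw [h₆]
    push_cast at hmul hsmall ⊢
    linarith

/-- There are `q` profiles in degree zero, `l` doubling steps and one final solve; `q ≥ 1` absorbs
the last. -/
theorem total_cost_le (hω : 2 ≤ ω) (hC₀ : 0 ≤ C₀)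
    (hmm : ∀ n, 1 ≤ n → ((mm n).cost : ℝ) ≤ C₀ * (n : ℝ) ^ ω) (hr : r = 2 ^ (ω - 2)) {k σ : ℕ}
    (hσ : 1 ≤ σ) (hk : 2 * σ ≤ dbl k) (hk' : dbl k ≤ 4 * σ) {m q l : ℕ} (hq : 1 ≤ q)
    (hmq : m ≤ q * σ) :
    ((q * rankCost mm σ k + l * doublingCost mm k σ + relationsCost mm k m σ : ℕ) : ℝ) ≤
      (1500 * (C₀ + 1)) * (σ ^ 2 * ∑ i ∈ Finset.range (k + 1), r ^ i) * (q + l) := by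
  have hr₁ : 1 ≤ r := hr ▸ Real.one_le_rpow one_le_two (by linarith)
  have hdk : (dbl k : ℝ) = 2 ^ k := by rw [dbl_eq]; norm_num
  have hkR : (dbl k : ℝ) ≤ 4 * σ := by exact_mod_cast hk'
  have hσR : (1 : ℝ) ≤ σ := by exact_mod_cast hσ
  set Φ : ℝ := σ ^ 2 * ∑ i ∈ Finset.range (k + 1), r ^ i with hΦ
  have hsum : r ^ k ≤ ∑ i ∈ Finset.range (k + 1), r ^ i :=
    Finset.single_le_sum (f := fun i => r ^ i) (fun i _ => by positivity)
      (Finset.self_mem_range_succ k)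
  have hΦσ : (σ : ℝ) ^ 2 ≤ Φ :=
    le_mul_of_one_le_right (by positivity) ((one_le_pow₀ hr₁).trans hsum)
  have hΦ₀ : 0 ≤ Φ := (by positivity : (0 : ℝ) ≤ σ ^ 2).trans hΦσ
  have hT : (rankCost mm σ k : ℝ) ≤ 460 * (C₀ + 1) * Φ := by
    refine (rankCost_le hω hC₀ hmm hr k le_rfl).trans ?_
    have h₁ : ((20 * (C₀ + 1) + 3) * (σ + dbl k) : ℝ) ≤ 23 * (C₀ + 1) * (5 * σ) :=
      mul_le_mul (by linarith) (by linarith) (by positivity) (by positivity)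
    have h₂ : (2 : ℝ) ^ k * ∑ i ∈ Finset.range (k + 1), r ^ i ≤
        4 * σ * ∑ i ∈ Finset.range (k + 1), r ^ i :=
      mul_le_mul_of_nonneg_right (hdk ▸ hkR) ((by positivity : 0 ≤ r ^ k).trans hsum)
    refine (mul_le_mul h₁ h₂ ?_ (by positivity)).trans (le_of_eq ?_)
    · exact mul_nonneg (by positivity) ((by positivity : 0 ≤ r ^ k).trans hsum)
    · rw [hΦ]
      ring
  have hB : (((mm (dbl k)).cost + dbl k * dbl k : ℕ) : ℝ) ≤ 16 * (C₀ + 1) * Φ := by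
    refine (cost_dbl_le hω hmm hr k).trans ?_
    have h₁ : (4 : ℝ) ^ k ≤ 16 * σ ^ 2 := by
      have : (4 : ℝ) ^ k = dbl k * dbl k := by
        rw [hdk, ← mul_pow]
        norm_num
      rw [this]
      nlinarith [Nat.cast_nonneg (α := ℝ) (dbl k)]
    have h₂ := mul_le_mul h₁ hsum (by positivity) (by positivity)
    have h₃ := mul_le_mul_of_nonneg_left h₂ (show 0 ≤ C₀ + 1 by linarith)
    refine h₃.trans (le_of_eq ?_)
    rw [hΦ]
    ring
  have hN : ((σ * dbl k : ℕ) : ℝ) ≤ 4 * Φ := by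
    rw [Nat.cast_mul]
    nlinarith
  have hσk : σ / dbl k = 0 := Nat.div_eq_of_lt (by omega)
  have hkk : dbl k / dbl k = 1 := Nat.div_self (one_le_dbl k)
  have hmk : m / dbl k + 1 ≤ 2 * q := by
    have h₁ : m / dbl k ≤ q :=
      calc m / dbl k ≤ m / σ := Nat.div_le_div_left (by omega) hσ
        _ ≤ q := Nat.div_le_of_le_mul (by rwa [mul_comm])
    omega
  set B : ℕ := (mm (dbl k)).cost + dbl k * dbl k with hBdef
  set T : ℕ := rankCost mm σ k with hTdef
  have hnat : q * T + l * doublingCost mm k σ + relationsCost mm k m σ ≤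
      (q + l) * (2 * T + 9 * B + σ * dbl k) := by
    have h₁ : doublingCost mm k σ = 3 * B + T := by
      simp only [doublingCost, mulCost, hσk, hkk, ← hBdef, ← hTdef]
      ring
    have h₂ : relationsCost mm k m σ = T + 2 * B + σ * dbl k + 2 * ((m / dbl k + 1) * B) := by
      simp only [relationsCost, mulCost, hσk, hkk, ← hBdef, ← hTdef]
      ring
    have h₃ := Nat.mul_le_mul_right B hmk
    have h₄ := Nat.mul_le_mul_right (T + 2 * B + σ * dbl k) hq
    rw [h₁, h₂]
    nlinarith [Nat.zero_le (l * T), Nat.zero_le (l * B), Nat.zero_le (q * B),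
      Nat.zero_le (l * (σ * dbl k))]
  -- The three bounds give `2 * 460 + 9 * 16 + 4 = 1068`, which is below `1500`.
  have hbound : ((2 * T + 9 * B + σ * dbl k : ℕ) : ℝ) ≤ 1500 * (C₀ + 1) * Φ := by
    have h₁ : 0 ≤ C₀ * Φ := mul_nonneg hC₀ hΦ₀
    rw [Nat.cast_add, Nat.cast_add, Nat.cast_mul 2, Nat.cast_mul 9]
    push_cast at hN ⊢
    nlinarith
  calc ((q * T + l * doublingCost mm k σ + relationsCost mm k m σ : ℕ) : ℝ)
      ≤ (((q + l) * (2 * T + 9 * B + σ * dbl k) : ℕ) : ℝ) := by exact_mod_cast hnat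
    _ = (q + l) * ((2 * T + 9 * B + σ * dbl k : ℕ) : ℝ) := by push_cast; ring
    _ ≤ (q + l) * (1500 * (C₀ + 1) * Φ) := mul_le_mul_of_nonneg_left hbound (by positivity)
    _ = _ := by ring

/-! ### Logarithms and geometric sums for the chosen size -/

theorem dbl_clog_bounds {σ : ℕ} (hσ : 1 ≤ σ) :
    2 * σ ≤ dbl (Nat.clog 2 (2 * σ)) ∧ dbl (Nat.clog 2 (2 * σ)) ≤ 4 * σ := by
  rw [dbl_eq]
  refine ⟨Nat.le_pow_clog one_lt_two _, ?_⟩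
  have h₁ := Nat.pow_pred_clog_lt_self one_lt_two (show 1 < 2 * σ by omega)
  have h₂ : Nat.clog 2 (2 * σ) = (Nat.clog 2 (2 * σ)).pred + 1 :=
    (Nat.succ_pred_eq_of_pos (Nat.clog_pos one_lt_two (by omega))).symm
  rw [h₂, pow_succ]
  omega

theorem clog_le_logb {n : ℕ} (hn : 1 ≤ n) : (Nat.clog 2 n : ℝ) ≤ 1 + Real.logb 2 n := by
  have h₁ := Real.natCeil_logb_natCast 2 n
  rw [← h₁, add_comm]
  exact (Nat.ceil_lt_add_one (Real.logb_nonneg (by norm_num) (by exact_mod_cast hn))).le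

theorem sum_range_clog_le {σ : ℕ} (hσ : 1 ≤ σ) :
    ((Nat.clog 2 (2 * σ) + 1 : ℕ) : ℝ) ≤ 4 * max 1 (Real.logb 2 σ) := by
  have h₁ := clog_le_logb (show 1 ≤ 2 * σ by omega)
  have hσ₀ : (σ : ℝ) ≠ 0 := by exact_mod_cast (by omega : σ ≠ 0)
  rw [Nat.cast_mul, Nat.cast_ofNat, Real.logb_mul two_ne_zero hσ₀, Real.logb_self_eq_one
    one_lt_two] at h₁
  have h₂ := le_max_left 1 (Real.logb 2 σ)
  have h₃ := le_max_right 1 (Real.logb 2 σ)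
  push_cast
  linarith

/-- The last term controls the geometric sum, and `r ^ k = (2 ^ k) ^ (ω - 2) ≤ (4 σ) ^ (ω - 2)`. -/
theorem geom_sum_clog_le {σ : ℕ} (hσ : 1 ≤ σ) (hω : 2 < ω) (hr : r = 2 ^ (ω - 2)) :
    (σ : ℝ) ^ 2 * ∑ i ∈ Finset.range (Nat.clog 2 (2 * σ) + 1), r ^ i ≤
      4 ^ (ω - 2) * (r / (r - 1)) * (σ : ℝ) ^ ω := by
  have hr₁ : 1 < r := hr ▸ Real.one_lt_rpow one_lt_two (by linarith)
  have hσ₀ : (0 : ℝ) < σ := by exact_mod_cast hσ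
  set k := Nat.clog 2 (2 * σ) with hk
  have h₁ : r ^ k ≤ 4 ^ (ω - 2) * (σ : ℝ) ^ (ω - 2) := by
    rw [hr, ← Real.rpow_natCast, ← Real.rpow_mul two_pos.le, mul_comm,
      Real.rpow_mul two_pos.le, Real.rpow_natCast, ← Real.mul_rpow (by norm_num) hσ₀.le]
    refine Real.rpow_le_rpow (by positivity) ?_ (by linarith)
    have := (dbl_clog_bounds hσ).2
    rw [dbl_eq] at this
    exact_mod_cast this
  have h₂ : ∑ i ∈ Finset.range (k + 1), r ^ i ≤ r / (r - 1) * r ^ k := by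
    rw [geom_sum_eq hr₁.ne', div_mul_eq_mul_div, pow_succ]
    refine div_le_div_of_nonneg_right ?_ (by linarith)
    linarith
  have h₃ : (σ : ℝ) ^ ω = σ ^ 2 * (σ : ℝ) ^ (ω - 2) := by
    rw [← Real.rpow_two, ← Real.rpow_add hσ₀]
    ring_nf
  have h₄ : 0 ≤ r / (r - 1) := div_nonneg (by linarith) (by linarith)
  calc (σ : ℝ) ^ 2 * ∑ i ∈ Finset.range (k + 1), r ^ i
      ≤ σ ^ 2 * (r / (r - 1) * (4 ^ (ω - 2) * (σ : ℝ) ^ (ω - 2))) :=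
        mul_le_mul_of_nonneg_left (h₂.trans (mul_le_mul_of_nonneg_left h₁ h₄)) (by positivity)
    _ = _ := by rw [h₃]; ring

end Cost

end Comp

/-- What the relations given by the pivot degrees yield. -/
theorem popov_conclusion {K : Type*} [Field K] {m σ : ℕ} {E : Matrix (Fin m) (Fin σ) K}
    {M : Matrix (Fin σ) (Fin σ) K} {s : Fin m → ℕ} {δ : ℕ} {e : Fin m → ℕ}
    {P : Matrix (Fin m) (Fin m) K[X]} (he : ∀ i d, IsStandardMonomial E M s (i, d) ↔ d < e i)
    (heδ : ∀ i, e i ≤ δ)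
    (hP : ∀ i j d, e j ≤ d → (P i j).coeff d = if i = j ∧ d = e j then 1 else 0)
    (hact : ∀ i, polyAct E M (P i) = 0) :
    IsMinimalInterpolationBasis s E M P ∧ IsPopov s P ∧
      (∀ P' : Matrix (Fin m) (Fin m) K[X],
        IsInterpolationBasis E M P' → IsPopov s P' → P' = P) ∧
      (∀ i j, (P i j).natDegree ≤ δ) ∧ ∑ j, colDeg P j ≤ σ := by
  refine ⟨⟨isInterpolationBasis_of_relations he hP hact, isShiftReduced_of_relations he hP hact⟩,
    isPopov_of_relations he hP hact, fun P' => eq_of_relations he hP hact,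
    fun i j => (natDegree_le_of_relations hP i j).trans (heδ j), ?_⟩
  refine le_trans (Finset.sum_le_sum fun j _ => ?_)
    (sum_pivotDegrees_le E M s fun i d => (he i d).2)
  exact Finset.sup_le fun i _ => natDegree_le_of_relations hP i j

theorem mainTheorem2 (ω : ℝ) (hω : IsMatMulExponent.{u} ω) :
    ∃ (C : ℝ) (alg : (m σ : ℕ) → (Fin m → ℕ) → ℕ → PolyMatProgram m σ),
      ∀ (K : Type u) [Field K] (m σ : ℕ) (_ : 1 ≤ σ) (E : Matrix (Fin m) (Fin σ) K)
        (M : Matrix (Fin σ) (Fin σ) K) (s : Fin m → ℕ) (δ : ℕ)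
        (_ : (minpoly K M).natDegree ≤ δ),
        ∃ (P : Matrix (Fin m) (Fin m) K[X]) (t : ℕ),
          (alg m σ s δ).Returns E M P t ∧
          (2 < ω → (t : ℝ) ≤
            C * ((σ : ℝ) ^ ω * ((⌈(m : ℝ) / (σ : ℝ)⌉₊ : ℝ) + Real.logb 2 (δ : ℝ)))) ∧
          (ω = 2 → (t : ℝ) ≤
            C * ((σ : ℝ) ^ 2 * ((⌈(m : ℝ) / (σ : ℝ)⌉₊ : ℝ) + Real.logb 2 (δ : ℝ)) *
              max 1 (Real.logb 2 (σ : ℝ)))) ∧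
          IsMinimalInterpolationBasis s E M P ∧
          IsPopov s P ∧
          (∀ P' : Matrix (Fin m) (Fin m) K[X],
            IsInterpolationBasis E M P' → IsPopov s P' → P' = P) ∧
          (∀ i j, (P i j).natDegree ≤ δ) ∧
          ∑ j, colDeg P j ≤ σ := by
  classical
  obtain ⟨C₀, hC⟩ := hω
  let mm : Comp.MulPrograms := fun n => if h : 1 ≤ n then (hC n h).choose else ⟨[], fun _ => .zero⟩
  have hmm : ∀ n (h : 1 ≤ n), mm n = (hC n h).choose := fun n h => dif_pos h
  have hcost : ∀ n, 1 ≤ n → ((mm n).cost : ℝ) ≤ C₀ * (n : ℝ) ^ ω := fun n h => by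
    rw [hmm n h]
    exact (hC n h).choose_spec.1
  have hcorrect : ∀ (K : Type u) [Field K], mm.Correct K := fun K _ n h A B i j => by
    rw [hmm n h]
    exact (hC n h).choose_spec.2 K A B i j
  have hC₀ : 0 ≤ C₀ := by
    have := hcost 1 le_rfl
    rw [Nat.cast_one, Real.one_rpow, mul_one] at this
    exact (Nat.cast_nonneg _).trans this
  set r : ℝ := 2 ^ (ω - 2) with hr
  -- The factors come from `sum_range_clog_le` and `geom_sum_clog_le`; for `ω < 2` no cost bound is
  -- claimed.
  let D : ℝ := if ω = 2 then 4 else if 2 < ω then 4 ^ (ω - 2) * (r / (r - 1)) else 0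
  have hD : 0 ≤ D := by
    simp only [D]
    split_ifs with h₁ h₂
    · norm_num
    · have hr₁ : 1 < r := Real.one_lt_rpow one_lt_two (by linarith)
      exact mul_nonneg (by positivity) (div_nonneg (by linarith) (by linarith))
    · exact le_rfl
  let C : ℝ := 3000 * (C₀ + 1) * D
  have hCnn : 0 ≤ C := by positivity
  -- For `m = 0` and `δ = 1` the bound is zero, so the program must stop at once.
  refine ⟨C, fun m σ s δ => if m = 0 then .done fun _ _ => [] else
    Comp.popovBasis mm (Nat.clog 2 (2 * σ)) m σ ⌈(m : ℝ) / (σ : ℝ)⌉₊ (Nat.clog 2 δ) δ s 0, ?_⟩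
  intro K _ m σ hσ E M s δ hδ
  obtain ⟨e, he, heM⟩ := exists_pivotDegrees E M s
  have hσ₀ : (0 : ℝ) < σ := by exact_mod_cast hσ
  have hδ₁ : 1 ≤ δ := by
    have : Nonempty (Fin σ) := ⟨⟨0, hσ⟩⟩
    exact (minpoly.natDegree_pos (Matrix.isIntegral (R := K) M)).trans_le hδ
  have hlog : 0 ≤ Real.logb 2 (δ : ℝ) := Real.logb_nonneg one_lt_two (by exact_mod_cast hδ₁)
  have heδ : ∀ i, e i ≤ δ := fun i => (heM i).trans hδ
  rcases Nat.eq_zero_or_pos m with rfl | hm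
  · refine ⟨fun i => i.elim0, 0, ⟨⟨[], fun _ _ => [], 0⟩, rfl, rfl, fun i => i.elim0⟩, fun _ => ?_,
      fun _ => ?_, popov_conclusion he heδ (fun i => i.elim0) (fun i => i.elim0)⟩
    · rw [Nat.cast_zero]
      positivity
    · rw [Nat.cast_zero]
      positivity
  set q : ℕ := ⌈(m : ℝ) / (σ : ℝ)⌉₊ with hq
  have hq₁ : 1 ≤ q := Nat.ceil_pos.2 (div_pos (by exact_mod_cast hm) hσ₀)
  have hmq : m ≤ q * σ := by
    have := Nat.le_ceil ((m : ℝ) / (σ : ℝ))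
    rw [div_le_iff₀ hσ₀] at this
    exact_mod_cast this
  obtain ⟨hk, hk'⟩ := Comp.dbl_clog_bounds hσ
  obtain ⟨x, hx, -, hops, hQ⟩ := Comp.sat_popovBasis (k := Nat.clog 2 (2 * σ)) (hcorrect K) hσ hk
    hmq hδ (Nat.le_pow_clog one_lt_two δ) he heM
  let P : Matrix (Fin m) (Fin m) K[X] := fun i j =>
    polyOfCoeffs ((x.out i j).map (Operand.eval (matrixInputs E M) x.regs))
  obtain ⟨hP, hact⟩ := hQ P fun _ _ => rfl
  have htotal : 2 ≤ ω → (x.ops : ℝ) ≤ 3000 * (C₀ + 1) *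
      (σ ^ 2 * ∑ i ∈ Finset.range (Nat.clog 2 (2 * σ) + 1), r ^ i) * (q + Real.logb 2 δ) := by
    intro hω₂
    refine (Nat.cast_le.2 hops).trans
      ((Comp.total_cost_le hω₂ hC₀ hcost hr hσ hk hk' hq₁ hmq).trans ?_)
    have h₁ := Comp.clog_le_logb hδ₁
    have h₂ : (1 : ℝ) ≤ q := by exact_mod_cast hq₁
    -- Rounding the logarithm up costs at most `1 ≤ q`; this doubles `1500` to `3000`.
    have h₃ : (q : ℝ) + Nat.clog 2 δ ≤ 2 * (q + Real.logb 2 δ) := by linarith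
    have h₄ : 0 ≤ 1500 * (C₀ + 1) *
        (σ ^ 2 * ∑ i ∈ Finset.range (Nat.clog 2 (2 * σ) + 1), r ^ i) := by positivity
    exact (mul_le_mul_of_nonneg_left h₃ h₄).trans (le_of_eq (by ring))
  refine ⟨P, x.ops, ⟨x, ?_, rfl, fun _ _ => rfl⟩, fun h => ?_, fun h => ?_,
    popov_conclusion he heδ hP hact⟩
  · exact (congrArg (FieldProgram.run (matrixInputs E M) · []) (if_neg hm.ne')).trans hx
  · have hDeq : D = 4 ^ (ω - 2) * (r / (r - 1)) := by
      simp only [D]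
      rw [if_neg h.ne', if_pos h]
    have h₁ := Comp.geom_sum_clog_le hσ h hr
    rw [← hDeq] at h₁
    refine (htotal h.le).trans ?_
    have h₂ := mul_le_mul_of_nonneg_left h₁ (show 0 ≤ 3000 * (C₀ + 1) by linarith)
    exact (mul_le_mul_of_nonneg_right h₂ (by positivity)).trans (le_of_eq (by ring))
  · have hr₁ : r = 1 := by rw [hr, h, sub_self, Real.rpow_zero]
    have hDeq : D = 4 := if_pos h
    have h₁ := htotal h.ge
    have h₂ := Comp.sum_range_clog_le hσ
    simp only [hr₁, one_pow, Finset.sum_const, Finset.card_range, nsmul_eq_mul, mul_one] at h₁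
    refine h₁.trans ?_
    have h₃ := mul_le_mul_of_nonneg_left h₂
      (show 0 ≤ 3000 * (C₀ + 1) * ((σ : ℝ) ^ 2 * (q + Real.logb 2 δ)) by positivity)
    simp only [C, hDeq]
    calc _ = 3000 * (C₀ + 1) * ((σ : ℝ) ^ 2 * (q + Real.logb 2 δ)) *
          ((Nat.clog 2 (2 * σ) + 1 : ℕ) : ℝ) := by ring
      _ ≤ _ := h₃
      _ = _ := by ring
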